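/- Let $\mathbb K=\mathbb R$ (smooth category) or $\mathbb K=\mathbb C$ (holomorphic category). Let $T\subseteq\mathbb K$ be open and let $F:T\to\mathbb K$ be differentiable and such that $f=F'$ is twice differentiable and solves the Airy equation $f''+tf=0$ on $T$. On $M=T\times\mathbb K^3$ with coordinates $(t,x,y,z)$ put $L_1=e^{-y}\partial_x$, $L_2=\partial_y$, $L_3=\partial_z$ and, for constants $c_1,c_2\in\mathbb K$, $$P=\tfrac12FL_1+L_2,\quad Q=\left(\tfrac12(c_1^2+t)F+c_1F'+F''\right)L_1+(c_1^2+t)L_2+c_2L_3,\quad R=\tfrac12(c_1F+F')L_1+c_1L_2+L_3,$$ $$W=-P,\quad \widetilde W=Q,\quad Z=\partial_t-R,\quad \widetilde Z=\partial_t+R.$$ Let $(\mathbf e_W,\mathbf e_{\widetilde W},\mathbf e_Z,\mathbf e_{\widetilde Z})$ denote the dual coframe of $(W,\widetilde W,Z,\widetilde Z)$, and write $\alpha\odot\beta=\alpha\otimes\beta+\beta\otimes\alpha$. Orient $M$ by the volume form $\mathrm{vol}$ with $\mathrm{vol}(W,\widetilde W,Z,\widetilde Z)=1$. A null-Kähler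 structure is a pair $(\hat g,N)$ of a metric $\hat g$ of signature $(2,2)$ (for $\mathbb K=\mathbb C$: a non-degenerate holomorphic metric) and an endomorphism $N$ of the tangent bundle, of rank $2$ at every point, with $N^2=0$, $\hat g(NX,Y)+\hat g(X,NY)=0$ and $\nabla N=0$ for the Levi-Civita connection $\nabla$ of $\hat g$; its null-Kähler two-form is $\Sigma(X,Y)=\hat g(NX,Y)$, and it satisfies $\nabla\Sigma=0$ and $\Sigma\wedge\Sigma=0$. The metric $\hat g$ is ASD if the self-dual part $\frac12(C+{*C})$ of its Weyl tensor $C$ vanishes, where $(*C)_{abcd}=\frac12\widehat{\mathrm{vol}}_{abef}C^{ef}{}_{cd}$ and $\widehat{\mathrm{vol}}$ is the metric volume form of $\hat g$ compatible with the orientation. 1. Let $c_1=c_2=0$ and suppose that $F''\neq0$ on $T$. Then the dual coframe is $$\mathbf e_{\widetilde Z}=\tfrac12(dt+dz),\qquad \mathbf e_{\widetilde W}=\tfrac1{F''}\left(e^y\,dx-\tfrac12F\,dy-\tfrac12F'\,dz\right),$$ $$\mathbf e_Z=\tfrac12(dt-dz),\qquad \mathbf e_W=\tfrac1{F''}\left(te^y\,dx-\left(\tfrac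 t2F+F''\right)dy-\tfrac t2F'\,dz\right),$$ and with $\Omega=e^{-y}F''$ the metric $$\hat g=\Omega\left(\mathbf e_Z\odot\mathbf e_{\widetilde Z}-\mathbf e_W\odot\mathbf e_{\widetilde W}\right),\qquad \widehat{\mathrm{vol}}=\Omega^2\,\mathrm{vol},$$ is ASD and null-Kähler (for a suitable $N$) with null-Kähler two-form $\Sigma=\Omega\,\mathbf e_{\widetilde Z}\wedge\mathbf e_{\widetilde W}$. 2. Let $c_1,c_2$ be arbitrary and suppose that $F''+(c_1-\frac{c_2}2)F'\neq0$ on $T$. Then $(W,\widetilde W,Z,\widetilde Z)$ is a frame on $M$, and with $\Omega=e^{-y}\left(F''+(c_1-\frac{c_2}2)F'\right)$ the metric $\hat g=\Omega(\mathbf e_Z\odot\mathbf e_{\widetilde Z}-\mathbf e_W\odot\mathbf e_{\widetilde W})$ with $\widehat{\mathrm{vol}}=\Omega^2\,\mathrm{vol}$ is ASD and null-Kähler (for a suitable $N$) with null-Kähler two-form $\Sigma=\Omega\,\mathbf e_{\widetilde Z}\wedge\mathbf e_{\widetilde W}$. -/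

import Mathlib

open scoped ContDiff Matrix

namespace AiryNullKahler

/-! ### Pseudo-Riemannian geometry in one chart of dimension four

The ground field `𝕜` is `ℝ` (smooth category) or `ℂ` (holomorphic category).  Points, tangent
vectors and one-forms are given by their four components in the chart. -/

section Geometry

variable {𝕜 : Type*} [RCLike 𝕜]

/-- The partial derivative `∂f/∂xⁱ` at `p`. -/
noncomputable def pd (i : Fin 4) (f : (Fin 4 → 𝕜) → 𝕜) (p : Fin 4 → 𝕜) : 𝕜 :=
  fderiv 𝕜 f p (Pi.single i 1)

/-- `g` is a smooth metric of signature `(2, 2)` on `U`: symmetric, and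
with a basis at every point in which it is `diag(1, 1, -1, -1)`.  (Over `ℂ` the last condition
says only that the holomorphic metric is non-degenerate.) -/
structure IsNeutralMetricOn (U : Set (Fin 4 → 𝕜))
    (g : (Fin 4 → 𝕜) → Matrix (Fin 4) (Fin 4) 𝕜) : Prop where
  smooth : ∀ i j, ContDiffOn 𝕜 ∞ (fun p => g p i j) U
  symm : ∀ p ∈ U, (g p).IsSymm
  signature : ∀ p ∈ U, ∃ A : Matrix (Fin 4) (Fin 4) 𝕜,
    IsUnit A.det ∧ Aᵀ * g p * A = Matrix.diagonal ![1, 1, -1, -1]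

/-- The Christoffel symbol `Γᵏᵢⱼ` of the Levi-Civita connection of `g`. -/
noncomputable def christoffel (g : (Fin 4 → 𝕜) → Matrix (Fin 4) (Fin 4) 𝕜) (k i j : Fin 4)
    (p : Fin 4 → 𝕜) : 𝕜 :=
  (1 / 2) * ∑ l, (g p)⁻¹ k l *
    (pd i (fun q => g q j l) p + pd j (fun q => g q i l) p - pd l (fun q => g q i j) p)

/-- The component `(∇ᵢ N)ᵏⱼ`, where `N p k j` is the component `Nᵏⱼ` of an endomorphism field. -/
noncomputable def covDerivEnd (g N : (Fin 4 → 𝕜) → Matrix (Fin 4) (Fin 4) 𝕜) (i k j : Fin 4)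
    (p : Fin 4 → 𝕜) : 𝕜 :=
  pd i (fun q => N q k j) p + ∑ l, christoffel g k i l p * N p l j
    - ∑ l, christoffel g l i j p * N p k l

/-- The component `(∇ᵢ S)ⱼₖ` for a covariant tensor field `S` of rank two. -/
noncomputable def covDerivForm (g S : (Fin 4 → 𝕜) → Matrix (Fin 4) (Fin 4) 𝕜) (i j k : Fin 4)
    (p : Fin 4 → 𝕜) : 𝕜 :=
  pd i (fun q => S q j k) p - ∑ l, christoffel g l i j p * S p l k
    - ∑ l, christoffel g l i k p * S p j l

/-- The component `Rˡₖᵢⱼ` of the curvature tensor, `R(∂ᵢ, ∂ⱼ)∂ₖ = Rˡₖᵢⱼ ∂ₗ`. -/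
noncomputable def riemannUp (g : (Fin 4 → 𝕜) → Matrix (Fin 4) (Fin 4) 𝕜) (l k i j : Fin 4)
    (p : Fin 4 → 𝕜) : 𝕜 :=
  pd i (christoffel g l j k) p - pd j (christoffel g l i k) p
    + ∑ m, (christoffel g l i m p * christoffel g m j k p
      - christoffel g l j m p * christoffel g m i k p)

/-- The component `Rₗₖᵢⱼ = gₗₘ Rᵐₖᵢⱼ`. -/
noncomputable def riemann (g : (Fin 4 → 𝕜) → Matrix (Fin 4) (Fin 4) 𝕜) (l k i j : Fin 4)
    (p : Fin 4 → 𝕜) : 𝕜 :=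
  ∑ m, g p l m * riemannUp g m k i j p

/-- The Ricci tensor `Ricₖⱼ = Rⁱₖᵢⱼ`. -/
noncomputable def ricci (g : (Fin 4 → 𝕜) → Matrix (Fin 4) (Fin 4) 𝕜) (k j : Fin 4)
    (p : Fin 4 → 𝕜) : 𝕜 :=
  ∑ i, riemannUp g i k i j p

/-- The scalar curvature. -/
noncomputable def scalarCurv (g : (Fin 4 → 𝕜) → Matrix (Fin 4) (Fin 4) 𝕜)
    (p : Fin 4 → 𝕜) : 𝕜 :=
  ∑ k, ∑ j, (g p)⁻¹ k j * ricci g k j p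

/-- The component `Cₗₖᵢⱼ` of the Weyl tensor in dimension four. -/
noncomputable def weyl (g : (Fin 4 → 𝕜) → Matrix (Fin 4) (Fin 4) 𝕜) (l k i j : Fin 4)
    (p : Fin 4 → 𝕜) : 𝕜 :=
  riemann g l k i j p
    - (1 / 2) * (g p l i * ricci g k j p - g p l j * ricci g k i p
      - g p k i * ricci g l j p + g p k j * ricci g l i p)
    + (scalarCurv g p / 6) * (g p l i * g p k j - g p l j * g p k i)

/-- The Levi-Civita symbol `ε_{abcd}` with `ε_{0123} = 1`. -/
noncomputable def leviCivita (a b c d : Fin 4) : 𝕜 :=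
  Matrix.det (Matrix.of ![Pi.single a (1 : 𝕜), Pi.single b 1, Pi.single c 1, Pi.single d 1])

/-- The Hodge dual of the Weyl tensor on its first pair of indices,
`(*C)_{abcd} = (1/2) vol_{abef} C^{ef}_{cd}`, for the volume form
`vol = ν dx⁰ ∧ dx¹ ∧ dx² ∧ dx³`. -/
noncomputable def starWeyl (g : (Fin 4 → 𝕜) → Matrix (Fin 4) (Fin 4) 𝕜)
    (ν : (Fin 4 → 𝕜) → 𝕜) (a b c d : Fin 4) (p : Fin 4 → 𝕜) : 𝕜 :=
  (1 / 2) * ∑ e, ∑ f, ν p * leviCivita a b e f *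
    ∑ e', ∑ f', (g p)⁻¹ e e' * (g p)⁻¹ f f' * weyl g e' f' c d p

/-- The self-dual part `C⁺ = (C + *C) / 2` of the Weyl tensor. -/
noncomputable def selfDualWeyl (g : (Fin 4 → 𝕜) → Matrix (Fin 4) (Fin 4) 𝕜)
    (ν : (Fin 4 → 𝕜) → 𝕜) (a b c d : Fin 4) (p : Fin 4 → 𝕜) : 𝕜 :=
  (1 / 2) * (weyl g a b c d p + starWeyl g ν a b c d p)

/-- The metric `g`, oriented by its volume form `ν dx⁰ ∧ dx¹ ∧ dx² ∧ dx³`, is anti-self-dual on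
`U`.  The condition `ν² = det g` says that this is a metric volume form; of the two smooth roots,
`ν` selects one, that is, an orientation. -/
structure IsASDOn (U : Set (Fin 4 → 𝕜)) (g : (Fin 4 → 𝕜) → Matrix (Fin 4) (Fin 4) 𝕜)
    (ν : (Fin 4 → 𝕜) → 𝕜) : Prop where
  vol_smooth : ContDiffOn 𝕜 ∞ ν U
  vol_sq : ∀ p ∈ U, ν p ^ 2 = (g p).det
  selfDual_eq_zero : ∀ p ∈ U, ∀ a b c d, selfDualWeyl g ν a b c d p = 0

/-- `(g, N)` is a null-Kähler structure on `U`. -/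
structure IsNullKahlerOn (U : Set (Fin 4 → 𝕜))
    (g N : (Fin 4 → 𝕜) → Matrix (Fin 4) (Fin 4) 𝕜) : Prop where
  metric : IsNeutralMetricOn U g
  smooth : ∀ k j, ContDiffOn 𝕜 ∞ (fun p => N p k j) U
  rank_eq : ∀ p ∈ U, (N p).rank = 2
  sq_eq_zero : ∀ p ∈ U, N p * N p = 0
  skew : ∀ p ∈ U, ∀ X Y : Fin 4 → 𝕜,
    (N p *ᵥ X) ⬝ᵥ (g p *ᵥ Y) + X ⬝ᵥ (g p *ᵥ (N p *ᵥ Y)) = 0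
  parallel : ∀ p ∈ U, ∀ i k j, covDerivEnd g N i k j p = 0

/-- The wedge product of two one-forms, `(α ∧ β)ᵢⱼ = αᵢ βⱼ - αⱼ βᵢ`. -/
def wedge (α β : Fin 4 → 𝕜) : Matrix (Fin 4) (Fin 4) 𝕜 :=
  Matrix.of fun i j => α i * β j - α j * β i

/-- The symmetric product of two one-forms, `α ⊙ β = α ⊗ β + β ⊗ α`. -/
def symProd (α β : Fin 4 → 𝕜) : Matrix (Fin 4) (Fin 4) 𝕜 :=
  Matrix.of fun i j => α i * β j + β i * α j

/-- The coefficient of `dx⁰ ∧ dx¹ ∧ dx² ∧ dx³` in the wedge product of two two-forms. -/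
def wedgeTop (S T : Matrix (Fin 4) (Fin 4) 𝕜) : 𝕜 :=
  S 0 1 * T 2 3 - S 0 2 * T 1 3 + S 0 3 * T 1 2
    + S 1 2 * T 0 3 - S 1 3 * T 0 2 + S 2 3 * T 0 1

/-- `S` is the null-Kähler two-form of `(g, N)` on `U`: a smooth two-form with
`S(X, Y) = g(N X, Y)`, `∇S = 0` and `S ∧ S = 0`. -/
structure IsNullKahlerFormOn (U : Set (Fin 4 → 𝕜))
    (g N S : (Fin 4 → 𝕜) → Matrix (Fin 4) (Fin 4) 𝕜) : Prop where
  smooth : ∀ i j, ContDiffOn 𝕜 ∞ (fun p => S p i j) U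
  alternating : ∀ p ∈ U, (S p)ᵀ = -S p
  eq_metric : ∀ p ∈ U, ∀ X Y : Fin 4 → 𝕜, X ⬝ᵥ (S p *ᵥ Y) = (N p *ᵥ X) ⬝ᵥ (g p *ᵥ Y)
  parallel : ∀ p ∈ U, ∀ i j k, covDerivForm g S i j k p = 0
  null : ∀ p ∈ U, wedgeTop (S p) (S p) = 0

/-- The one-forms `θ a` are the coframe dual to the frame `e` on `U`. -/
def IsDualCoframeOn (U : Set (Fin 4 → 𝕜)) (e θ : Fin 4 → (Fin 4 → 𝕜) → (Fin 4 → 𝕜)) : Prop :=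
  ∀ p ∈ U, ∀ a b, θ a p ⬝ᵥ e b p = if a = b then 1 else 0

end Geometry

/-! ### The cohomogeneity-one structure

The coordinates are `(p 0, p 1, p 2, p 3) = (t, x, y, z)`.  Tetrads and coframes are always listed
in the order `W, W̃, Z, Z̃`. -/

section Airy

variable {𝕜 : Type*} [RCLike 𝕜]

/-- `f` solves the Airy equation `f'' + t f = 0` on `T`. -/
def SolvesAiryOn (f : 𝕜 → 𝕜) (T : Set 𝕜) : Prop :=
  ∀ t ∈ T, DifferentiableAt 𝕜 f t ∧ DifferentiableAt 𝕜 (deriv f) t ∧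
    deriv (deriv f) t + t * f t = 0

/-- The part `T × G` of the four-manifold, `G = 𝕜³` with coordinates `(x, y, z)`. -/
def domainOver (T : Set 𝕜) : Set (Fin 4 → 𝕜) := {p | p 0 ∈ T}

/-- The vector field `∂_t`. -/
def vecT (_p : Fin 4 → 𝕜) : Fin 4 → 𝕜 := ![1, 0, 0, 0]

/-- The left-invariant vector field `L₁ = e^{-y} ∂_x`. -/
noncomputable def vecL1 (p : Fin 4 → 𝕜) : Fin 4 → 𝕜 := ![0, NormedSpace.exp (-p 2), 0, 0]

/-- The left-invariant vector field `L₂ = ∂_y`. -/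
def vecL2 (_p : Fin 4 → 𝕜) : Fin 4 → 𝕜 := ![0, 0, 1, 0]

/-- The left-invariant vector field `L₃ = ∂_z`. -/
def vecL3 (_p : Fin 4 → 𝕜) : Fin 4 → 𝕜 := ![0, 0, 0, 1]

/-- `P = (1/2) F L₁ + L₂`. -/
noncomputable def vecP (F : 𝕜 → 𝕜) (p : Fin 4 → 𝕜) : Fin 4 → 𝕜 :=
  ((1 / 2) * F (p 0)) • vecL1 p + vecL2 p

/-- `Q = ((1/2) (c₁² + t) F + c₁ F' + F'') L₁ + (c₁² + t) L₂ + c₂ L₃`. -/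
noncomputable def vecQ (F : 𝕜 → 𝕜) (c₁ c₂ : 𝕜) (p : Fin 4 → 𝕜) : Fin 4 → 𝕜 :=
  ((1 / 2) * (c₁ ^ 2 + p 0) * F (p 0) + c₁ * deriv F (p 0) + deriv (deriv F) (p 0)) • vecL1 p
    + (c₁ ^ 2 + p 0) • vecL2 p + c₂ • vecL3 p

/-- `R = (1/2) (c₁ F + F') L₁ + c₁ L₂ + L₃`. -/
noncomputable def vecR (F : 𝕜 → 𝕜) (c₁ : 𝕜) (p : Fin 4 → 𝕜) : Fin 4 → 𝕜 :=
  ((1 / 2) * (c₁ * F (p 0) + deriv F (p 0))) • vecL1 p + c₁ • vecL2 p + vecL3 p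

/-- The null tetrad `W = -P`, `W̃ = Q`, `Z = ∂_t - R`, `Z̃ = ∂_t + R`. -/
noncomputable def tetrad (F : 𝕜 → 𝕜) (c₁ c₂ : 𝕜) : Fin 4 → (Fin 4 → 𝕜) → (Fin 4 → 𝕜) :=
  ![fun p => -vecP F p, vecQ F c₁ c₂, fun p => vecT p - vecR F c₁ p,
    fun p => vecT p + vecR F c₁ p]

/-- The explicit one-forms `e_W, e_W̃, e_Z, e_Z̃` for `c₁ = c₂ = 0`. -/
noncomputable def coframeZero (F : 𝕜 → 𝕜) : Fin 4 → (Fin 4 → 𝕜) → (Fin 4 → 𝕜) :=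
  ![fun p => (1 / deriv (deriv F) (p 0)) •
      ![0, p 0 * NormedSpace.exp (p 2), -((p 0 / 2) * F (p 0) + deriv (deriv F) (p 0)),
        -((p 0 / 2) * deriv F (p 0))],
    fun p => (1 / deriv (deriv F) (p 0)) •
      ![0, NormedSpace.exp (p 2), -((1 / 2) * F (p 0)), -((1 / 2) * deriv F (p 0))],
    fun _ => (1 / 2 : 𝕜) • ![1, 0, 0, -1],
    fun _ => (1 / 2 : 𝕜) • ![1, 0, 0, 1]]

/-- The metric `Ω (e_Z ⊙ e_Z̃ - e_W ⊙ e_W̃)`. -/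
def tetradMetric (Ω : (Fin 4 → 𝕜) → 𝕜) (θ : Fin 4 → (Fin 4 → 𝕜) → (Fin 4 → 𝕜))
    (p : Fin 4 → 𝕜) : Matrix (Fin 4) (Fin 4) 𝕜 :=
  Ω p • (symProd (θ 2 p) (θ 3 p) - symProd (θ 0 p) (θ 1 p))

/-- The coefficient of the volume form `Ω² e_W ∧ e_W̃ ∧ e_Z ∧ e_Z̃` of `tetradMetric Ω θ`. -/
noncomputable def tetradVol (Ω : (Fin 4 → 𝕜) → 𝕜)
    (θ : Fin 4 → (Fin 4 → 𝕜) → (Fin 4 → 𝕜)) (p : Fin 4 → 𝕜) : 𝕜 :=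
  Ω p ^ 2 * Matrix.det (Matrix.of fun a => θ a p)

/-- The two-form `Ω e_Z̃ ∧ e_W̃`. -/
def tetradForm (Ω : (Fin 4 → 𝕜) → 𝕜) (θ : Fin 4 → (Fin 4 → 𝕜) → (Fin 4 → 𝕜))
    (p : Fin 4 → 𝕜) : Matrix (Fin 4) (Fin 4) 𝕜 :=
  Ω p • wedge (θ 3 p) (θ 1 p)

/-- The conformal factor `Ω = e^{-y} F''`. -/
noncomputable def confFactorZero (F : 𝕜 → 𝕜) (p : Fin 4 → 𝕜) : 𝕜 :=
  NormedSpace.exp (-p 2) * deriv (deriv F) (p 0)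

/-- The conformal factor `Ω = e^{-y} (F'' + (c₁ - c₂ / 2) F')`. -/
noncomputable def confFactor (F : 𝕜 → 𝕜) (c₁ c₂ : 𝕜) (p : Fin 4 → 𝕜) : 𝕜 :=
  NormedSpace.exp (-p 2) * (deriv (deriv F) (p 0) + (c₁ - c₂ / 2) * deriv F (p 0))

end Airy

end AiryNullKahler

/-!
# The cohomogeneity-one anti-self-dual null-Kähler metrics of the Airy equation

Put `κ = c₁ - c₂ / 2`, `k = F'' + κ F'` and `u = e^{-y}`, so that `Ω = u k`.  A constant change of
the dual coframe, combined with a rescaling by `Ω` of two of its members (`gaugeMat`), brings metric,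
two-form and volume form to
`g = θ² ⊙ θ³ - θ⁰ ⊙ θ¹`, `Σ = θ³ ∧ θ¹`, `vol = θ⁰ ∧ θ¹ ∧ θ² ∧ θ³`, where
`θ⁰ = -dy + κ dz + (κ² + t) θ¹ / Ω`, `θ¹ = dx - u (F dy + F' dz) / 2`, `θ² = Ω (dt - dz) / 2`,
`θ³ = (dt + dz) / 2` (`airyCoframe`, `airyCoframe_eq_gauge`).  Only `κ` is left of the two constants,
and the case `c₁ = c₂ = 0` is a special case of the general one.

In this coframe the Levi-Civita connection can be written down: `IsAiryData.torsion` verifies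
Cartan's first structure equation for connection matrices (`airyConn`) in the Lie algebra
`𝔰𝔩₂ ⊕ 𝕜 n` of infinitesimal isometries of `g` that fix `Σ` (`spinMat`).  Here `n` is the nilpotent
endomorphism with `Σ(X, Y) = g(n X, Y)`.  The Airy equation is what makes this possible.  Since the
connection matrices commute with `n`, both `N = n` and `Σ` are parallel
(`IsCartanConnectionOn.covDerivEnd_eq_zero`, `IsCartanConnectionOn.covDerivForm_eq_zero`).

Up to sign, the self-dual part of the curvature is then `dβ ⊗ n`, where `β = θ¹ / Ω` is, with the
same sign, the `n`-component of the connection.  The two-form `dβ` is anti-self-dual (`IsAiryData.nilForm_curvature`), so the block of the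
curvature operator from self-dual to self-dual forms vanishes, and by the first Bianchi identity
so do the scalar curvature and the self-dual Weyl tensor (`frameWeyl_spinCurv`,
`IsCartanConnectionOn.selfDualWeyl_eq_zero`).
-/

namespace AiryNullKahler

/-! ### Differential calculus of matrix-valued functions -/

section Calculus

variable {𝕜 : Type*} [RCLike 𝕜] {U : Set (Fin 4 → 𝕜)}

/-- Every entry of the matrix field `A` is smooth on `U`. -/
def IsSmoothOn (U : Set (Fin 4 → 𝕜)) (A : (Fin 4 → 𝕜) → Matrix (Fin 4) (Fin 4) 𝕜) : Prop :=
  ∀ a b, ContDiffOn 𝕜 ∞ (fun p => A p a b) U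

/-- The entrywise partial derivative `∂A/∂xⁱ` of a matrix field. -/
noncomputable def pdMat (i : Fin 4) (A : (Fin 4 → 𝕜) → Matrix (Fin 4) (Fin 4) 𝕜)
    (p : Fin 4 → 𝕜) : Matrix (Fin 4) (Fin 4) 𝕜 :=
  Matrix.of fun a b => pd i (fun q => A q a b) p

theorem pdMat_apply (i : Fin 4) (A : (Fin 4 → 𝕜) → Matrix (Fin 4) (Fin 4) 𝕜) (p : Fin 4 → 𝕜)
    (a b : Fin 4) : pdMat i A p a b = pd i (fun q => A q a b) p := rfl

theorem pd_congr (hU : IsOpen U) {f g : (Fin 4 → 𝕜) → 𝕜} (h : ∀ p ∈ U, f p = g p)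
    {p : Fin 4 → 𝕜} (hp : p ∈ U) (i : Fin 4) : pd i f p = pd i g p := by
  have : f =ᶠ[nhds p] g := Filter.eventually_of_mem (hU.mem_nhds hp) h
  simp only [pd, this.fderiv_eq]

theorem pdMat_congr (hU : IsOpen U) {A B : (Fin 4 → 𝕜) → Matrix (Fin 4) (Fin 4) 𝕜}
    (h : ∀ p ∈ U, A p = B p) {p : Fin 4 → 𝕜} (hp : p ∈ U) (i : Fin 4) :
    pdMat i A p = pdMat i B p := by
  ext a b
  exact pd_congr hU (fun q hq => by rw [h q hq]) hp i

theorem pd_const (i : Fin 4) (c : 𝕜) (p : Fin 4 → 𝕜) : pd i (fun _ => c) p = 0 := by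
  simp [pd]

theorem pd_add {f g : (Fin 4 → 𝕜) → 𝕜} {p : Fin 4 → 𝕜} (hf : DifferentiableAt 𝕜 f p)
    (hg : DifferentiableAt 𝕜 g p) (i : Fin 4) :
    pd i (fun q => f q + g q) p = pd i f p + pd i g p := by
  simp [pd, fderiv_fun_add hf hg]

theorem pd_mul {f g : (Fin 4 → 𝕜) → 𝕜} {p : Fin 4 → 𝕜} (hf : DifferentiableAt 𝕜 f p)
    (hg : DifferentiableAt 𝕜 g p) (i : Fin 4) :
    pd i (fun q => f q * g q) p = pd i f p * g p + f p * pd i g p := by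
  simp [pd, fderiv_fun_mul hf hg]
  ring

theorem contDiffOn_pd (hU : IsOpen U) {f : (Fin 4 → 𝕜) → 𝕜} (hf : ContDiffOn 𝕜 ∞ f U)
    (i : Fin 4) : ContDiffOn 𝕜 ∞ (pd i f) U :=
  (hf.fderiv_of_isOpen hU (by simp)).clm_apply contDiffOn_const

theorem pd_comm (hU : IsOpen U) {f : (Fin 4 → 𝕜) → 𝕜} (hf : ContDiffOn 𝕜 ∞ f U)
    {p : Fin 4 → 𝕜} (hp : p ∈ U) (i j : Fin 4) : pd i (pd j f) p = pd j (pd i f) p := by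
  have hc : ContDiffAt 𝕜 ∞ f p := hf.contDiffAt (hU.mem_nhds hp)
  have hd : DifferentiableAt 𝕜 (fderiv 𝕜 f) p :=
    ((hf.fderiv_of_isOpen (m := ∞) hU (by simp)).contDiffAt (hU.mem_nhds hp)).differentiableAt
      (by simp)
  have hs : IsSymmSndFDerivAt 𝕜 f p := hc.isSymmSndFDerivAt (by
    rw [minSmoothness_of_isRCLikeNormedField]; exact WithTop.coe_le_coe.2 (le_top : (2 : ℕ∞) ≤ ⊤))
  have key : ∀ k l, pd k (pd l f) p
      = fderiv 𝕜 (fderiv 𝕜 f) p (Pi.single k 1) (Pi.single l 1) := by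
    intro k l
    have : fderiv 𝕜 (fun q => fderiv 𝕜 f q (Pi.single l 1)) p = _ :=
      (hd.hasFDerivAt.clm_apply (hasFDerivAt_const _ p)).fderiv
    change fderiv 𝕜 (fun q => fderiv 𝕜 f q (Pi.single l 1)) p _ = _
    rw [this]
    simp
  rw [key, key]
  exact hs _ _

namespace IsSmoothOn

variable {A B : (Fin 4 → 𝕜) → Matrix (Fin 4) (Fin 4) 𝕜}

theorem differentiableAt (hA : IsSmoothOn U A) (hU : IsOpen U) {p : Fin 4 → 𝕜} (hp : p ∈ U)
    (a b : Fin 4) : DifferentiableAt 𝕜 (fun q => A q a b) p :=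
  ((hA a b).contDiffAt (hU.mem_nhds hp)).differentiableAt (by simp)

theorem const (C : Matrix (Fin 4) (Fin 4) 𝕜) : IsSmoothOn U fun _ => C :=
  fun _ _ => contDiffOn_const

theorem add (hA : IsSmoothOn U A) (hB : IsSmoothOn U B) : IsSmoothOn U fun p => A p + B p :=
  fun a b => (hA a b).add (hB a b)

theorem mul (hA : IsSmoothOn U A) (hB : IsSmoothOn U B) : IsSmoothOn U fun p => A p * B p := by
  intro a b
  simp only [Matrix.mul_apply]
  exact ContDiffOn.sum fun c _ => (hA a c).mul (hB c b)

theorem transpose (hA : IsSmoothOn U A) : IsSmoothOn U fun p => (A p)ᵀ :=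
  fun a b => hA b a

theorem pdMat (hA : IsSmoothOn U A) (hU : IsOpen U) (i : Fin 4) :
    IsSmoothOn U (pdMat i A) :=
  fun a b => contDiffOn_pd hU (hA a b) i

end IsSmoothOn

variable {A B : (Fin 4 → 𝕜) → Matrix (Fin 4) (Fin 4) 𝕜}

theorem pdMat_const (i : Fin 4) (C : Matrix (Fin 4) (Fin 4) 𝕜) (p : Fin 4 → 𝕜) :
    pdMat i (fun _ => C) p = 0 := by
  ext a b
  exact pd_const i _ p

theorem pdMat_transpose (i : Fin 4) (p : Fin 4 → 𝕜) :
    pdMat i (fun q => (A q)ᵀ) p = (pdMat i A p)ᵀ := rfl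

theorem pdMat_add (hU : IsOpen U) (hA : IsSmoothOn U A) (hB : IsSmoothOn U B) {p : Fin 4 → 𝕜}
    (hp : p ∈ U) (i : Fin 4) :
    pdMat i (fun q => A q + B q) p = pdMat i A p + pdMat i B p := by
  ext a b
  exact pd_add (hA.differentiableAt hU hp a b) (hB.differentiableAt hU hp a b) i

theorem pdMat_mul (hU : IsOpen U) (hA : IsSmoothOn U A) (hB : IsSmoothOn U B) {p : Fin 4 → 𝕜}
    (hp : p ∈ U) (i : Fin 4) :
    pdMat i (fun q => A q * B q) p = pdMat i A p * B p + A p * pdMat i B p := by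
  ext a b
  have hA' := fun c => hA.differentiableAt hU hp a c
  have hB' := fun c => hB.differentiableAt hU hp c b
  have hs : pd i (fun q => ∑ c, A q a c * B q c b) p
      = ∑ c, pd i (fun q => A q a c * B q c b) p := by
    simp only [pd]
    rw [fderiv_fun_sum (A := fun c q => A q a c * B q c b) fun c _ => (hA' c).fun_mul (hB' c)]
    simp
  simp only [pdMat_apply, Matrix.mul_apply, Matrix.add_apply]
  rw [hs, ← Finset.sum_add_distrib]
  exact Finset.sum_congr rfl fun c _ => pd_mul (hA' c) (hB' c) i

theorem pdMat_comm (hU : IsOpen U) (hA : IsSmoothOn U A) {p : Fin 4 → 𝕜} (hp : p ∈ U)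
    (i j : Fin 4) : pdMat i (pdMat j A) p = pdMat j (pdMat i A) p := by
  ext a b
  exact pd_comm hU (hA a b) hp i j

end Calculus

/-! ### The Levi-Civita connection in a coframe of constant metric coefficients -/

section Cartan

variable {𝕜 : Type*} [RCLike 𝕜] {U : Set (Fin 4 → 𝕜)}

/-- Cartan's description of the Levi-Civita connection on `U` of the metric `Θᵀ η Θ`, `η` constant.
The rows of `Θ p` are the one-forms of a coframe, the columns of `E p` the dual frame, and
`φ i p` is the value on `∂ᵢ` of the matrix of connection one-forms.  The connection is
metric (`skew`) and torsion-free (`torsion`, which is `dθᵃ + φᵃ_b ∧ θᵇ = 0`).  For simplicity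
`η` is its own inverse. -/
structure IsCartanConnectionOn (U : Set (Fin 4 → 𝕜)) (η : Matrix (Fin 4) (Fin 4) 𝕜)
    (Θ E : (Fin 4 → 𝕜) → Matrix (Fin 4) (Fin 4) 𝕜)
    (φ : Fin 4 → (Fin 4 → 𝕜) → Matrix (Fin 4) (Fin 4) 𝕜) : Prop where
  isOpen : IsOpen U
  metric_symm : ηᵀ = η
  metric_sq : η * η = 1
  smooth_coframe : IsSmoothOn U Θ
  smooth_frame : IsSmoothOn U E
  smooth_conn : ∀ i, IsSmoothOn U (φ i)
  coframe_mul_frame : ∀ p ∈ U, Θ p * E p = 1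
  skew : ∀ i, ∀ p ∈ U, (φ i p)ᵀ * η + η * φ i p = 0
  torsion : ∀ p ∈ U, ∀ i j a, (pdMat i Θ p + φ i p * Θ p) a j = (pdMat j Θ p + φ j p * Θ p) a i

/-- The connection matrices in coordinates, `(Γᵢ)ᵏⱼ`, obtained from those in the coframe by a
gauge transformation. -/
noncomputable def connMat (Θ E : (Fin 4 → 𝕜) → Matrix (Fin 4) (Fin 4) 𝕜)
    (φ : Fin 4 → (Fin 4 → 𝕜) → Matrix (Fin 4) (Fin 4) 𝕜) (i : Fin 4) (p : Fin 4 → 𝕜) :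
    Matrix (Fin 4) (Fin 4) 𝕜 :=
  E p * (pdMat i Θ p + φ i p * Θ p)

/-- The curvature two-form `dφ + φ ∧ φ` evaluated on `∂ᵢ, ∂ⱼ`. -/
noncomputable def curvMat (φ : Fin 4 → (Fin 4 → 𝕜) → Matrix (Fin 4) (Fin 4) 𝕜) (i j : Fin 4)
    (p : Fin 4 → 𝕜) : Matrix (Fin 4) (Fin 4) 𝕜 :=
  pdMat i (φ j) p - pdMat j (φ i) p + (φ i p * φ j p - φ j p * φ i p)

namespace IsCartanConnectionOn

variable {η : Matrix (Fin 4) (Fin 4) 𝕜} {Θ E : (Fin 4 → 𝕜) → Matrix (Fin 4) (Fin 4) 𝕜}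
  {φ : Fin 4 → (Fin 4 → 𝕜) → Matrix (Fin 4) (Fin 4) 𝕜}
  {g : (Fin 4 → 𝕜) → Matrix (Fin 4) (Fin 4) 𝕜}

theorem frame_mul_coframe (h : IsCartanConnectionOn U η Θ E φ) {p : Fin 4 → 𝕜} (hp : p ∈ U) :
    E p * Θ p = 1 :=
  mul_eq_one_comm.mp (h.coframe_mul_frame p hp)

theorem smooth_metric (h : IsCartanConnectionOn U η Θ E φ)
    (hg : ∀ p ∈ U, g p = (Θ p)ᵀ * η * Θ p) : IsSmoothOn U g := fun a b =>
  (((h.smooth_coframe.transpose.mul (.const η)).mul h.smooth_coframe) a b).congr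
    fun p hp => by rw [hg p hp]

theorem metric_inv (h : IsCartanConnectionOn U η Θ E φ)
    (hg : ∀ p ∈ U, g p = (Θ p)ᵀ * η * Θ p) {p : Fin 4 → 𝕜} (hp : p ∈ U) :
    (g p)⁻¹ = E p * η * (E p)ᵀ := by
  apply Matrix.inv_eq_right_inv
  have hT : (Θ p)ᵀ * (E p)ᵀ = 1 := by
    rw [← Matrix.transpose_mul, h.frame_mul_coframe hp, Matrix.transpose_one]
  calc g p * (E p * η * (E p)ᵀ) = (Θ p)ᵀ * (η * (Θ p * E p) * η) * (E p)ᵀ := by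
        rw [hg p hp]; simp only [Matrix.mul_assoc]
    _ = 1 := by
        rw [h.coframe_mul_frame p hp, Matrix.mul_one, h.metric_sq, Matrix.mul_one, hT]

theorem connMat_symm (h : IsCartanConnectionOn U η Θ E φ) {p : Fin 4 → 𝕜} (hp : p ∈ U)
    (i j k : Fin 4) : connMat Θ E φ i p k j = connMat Θ E φ j p k i := by
  simp only [connMat, Matrix.mul_apply (M := E p)]
  exact Finset.sum_congr rfl fun a _ => by rw [h.torsion p hp]

theorem coframe_mul_connMat (h : IsCartanConnectionOn U η Θ E φ) {p : Fin 4 → 𝕜} (hp : p ∈ U)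
    (i : Fin 4) : Θ p * connMat Θ E φ i p = pdMat i Θ p + φ i p * Θ p := by
  rw [connMat, ← Matrix.mul_assoc, h.coframe_mul_frame p hp, Matrix.one_mul]

/-- A bilinear form with constant coefficients `s` in the coframe is parallel if the connection
matrices are infinitesimal isometries of `s`. -/
theorem pdMat_form (h : IsCartanConnectionOn U η Θ E φ) (s : Matrix (Fin 4) (Fin 4) 𝕜)
    {S : (Fin 4 → 𝕜) → Matrix (Fin 4) (Fin 4) 𝕜} (hS : ∀ p ∈ U, S p = (Θ p)ᵀ * s * Θ p)
    (i : Fin 4) {p : Fin 4 → 𝕜} (hp : p ∈ U) (hs : (φ i p)ᵀ * s + s * φ i p = 0) :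
    pdMat i S p = (connMat Θ E φ i p)ᵀ * S p + S p * connMat Θ E φ i p := by
  have hΘ := h.smooth_coframe
  have hU := h.isOpen
  have e1 : pdMat i S p = (pdMat i Θ p)ᵀ * s * Θ p + (Θ p)ᵀ * s * pdMat i Θ p := by
    rw [pdMat_congr hU hS hp, pdMat_mul hU (hΘ.transpose.mul (.const s)) hΘ hp,
      pdMat_mul hU hΘ.transpose (.const s) hp, pdMat_const, pdMat_transpose]
    simp
  have e2 : S p * connMat Θ E φ i p
      = (Θ p)ᵀ * s * pdMat i Θ p + (Θ p)ᵀ * (s * φ i p) * Θ p := by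
    rw [hS p hp, Matrix.mul_assoc, h.coframe_mul_connMat hp, Matrix.mul_add]
    simp only [Matrix.mul_assoc]
  have e3 : (connMat Θ E φ i p)ᵀ * S p
      = (pdMat i Θ p)ᵀ * s * Θ p + (Θ p)ᵀ * ((φ i p)ᵀ * s) * Θ p := by
    rw [hS p hp, ← Matrix.mul_assoc, ← Matrix.mul_assoc, ← Matrix.transpose_mul,
      h.coframe_mul_connMat hp, Matrix.transpose_add, Matrix.transpose_mul, Matrix.add_mul,
      Matrix.add_mul]
    simp only [Matrix.mul_assoc]
  have e4 : (Θ p)ᵀ * ((φ i p)ᵀ * s) * Θ p + (Θ p)ᵀ * (s * φ i p) * Θ p = 0 := by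
    rw [← Matrix.add_mul, ← Matrix.mul_add, hs]; simp
  rw [e1, e2, e3, add_add_add_comm, e4, add_zero]

/-- The Koszul formula: a symmetric connection compatible with `g` has the Christoffel symbols
of `g` as its coefficients. -/
theorem christoffel_eq (h : IsCartanConnectionOn U η Θ E φ)
    (hg : ∀ p ∈ U, g p = (Θ p)ᵀ * η * Θ p) {p : Fin 4 → 𝕜} (hp : p ∈ U) (k i j : Fin 4) :
    christoffel g k i j p = connMat Θ E φ i p k j := by
  have hgs : (g p)ᵀ = g p := by
    rw [hg p hp]; simp [Matrix.transpose_mul, h.metric_symm, Matrix.mul_assoc]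
  have hinv : (g p)⁻¹ * g p = 1 := by
    refine Matrix.nonsing_inv_mul _ ?_
    rw [hg p hp]
    have hd : IsUnit (Θ p).det := IsUnit.of_mul_eq_one (E p).det (by
      rw [← Matrix.det_mul, h.coframe_mul_frame p hp, Matrix.det_one])
    have he : IsUnit η.det := IsUnit.of_mul_eq_one η.det (by
      rw [← Matrix.det_mul, h.metric_sq, Matrix.det_one])
    simp only [Matrix.det_mul, Matrix.det_transpose]
    exact (hd.mul he).mul hd
  have hd : ∀ a b c, pd a (fun q => g q b c) p
      = (g p * connMat Θ E φ a p) c b + (g p * connMat Θ E φ a p) b c := by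
    intro a b c
    have := congrFun (congrFun (h.pdMat_form η hg a hp (h.skew a p hp)) b) c
    rw [pdMat_apply] at this
    have hT : (connMat Θ E φ a p)ᵀ * g p = (g p * connMat Θ E φ a p)ᵀ := by
      rw [Matrix.transpose_mul, hgs]
    rw [this, Matrix.add_apply, hT, Matrix.transpose_apply]
  have hsym : ∀ a b c, (g p * connMat Θ E φ a p) b c = (g p * connMat Θ E φ c p) b a := by
    intro a b c
    simp only [Matrix.mul_apply]
    exact Finset.sum_congr rfl fun m _ => by rw [h.connMat_symm hp]
  have hl : ∀ l, pd i (fun q => g q j l) p + pd j (fun q => g q i l) p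
      - pd l (fun q => g q i j) p = 2 * (g p * connMat Θ E φ i p) l j := by
    intro l
    rw [hd, hd, hd, hsym j l i, hsym j i l, hsym l j i]
    ring
  calc christoffel g k i j p
      = (1 / 2) * ∑ l, (g p)⁻¹ k l * (2 * (g p * connMat Θ E φ i p) l j) := by
        simp only [christoffel, hl]
    _ = ((g p)⁻¹ * (g p * connMat Θ E φ i p)) k j := by
        rw [Matrix.mul_apply, Finset.mul_sum]
        exact Finset.sum_congr rfl fun l _ => by ring
    _ = connMat Θ E φ i p k j := by rw [← Matrix.mul_assoc, hinv, Matrix.one_mul]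

theorem covDerivForm_eq_zero (h : IsCartanConnectionOn U η Θ E φ)
    (hg : ∀ p ∈ U, g p = (Θ p)ᵀ * η * Θ p) (s : Matrix (Fin 4) (Fin 4) 𝕜)
    {S : (Fin 4 → 𝕜) → Matrix (Fin 4) (Fin 4) 𝕜} (hS : ∀ p ∈ U, S p = (Θ p)ᵀ * s * Θ p)
    (hs : ∀ i, ∀ p ∈ U, (φ i p)ᵀ * s + s * φ i p = 0) {p : Fin 4 → 𝕜} (hp : p ∈ U)
    (i j k : Fin 4) : covDerivForm g S i j k p = 0 := by
  have := congrFun (congrFun (h.pdMat_form s hS i hp (hs i p hp)) j) k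
  simp only [pdMat_apply, Matrix.add_apply, Matrix.mul_apply, Matrix.transpose_apply] at this
  simp only [covDerivForm, h.christoffel_eq hg hp, this, mul_comm (S p j _)]
  ring

theorem pdMat_frame (h : IsCartanConnectionOn U η Θ E φ) {p : Fin 4 → 𝕜} (hp : p ∈ U)
    (i : Fin 4) : pdMat i E p = -(E p * pdMat i Θ p * E p) := by
  have h0 : pdMat i Θ p * E p + Θ p * pdMat i E p = 0 := by
    rw [← pdMat_mul h.isOpen h.smooth_coframe h.smooth_frame hp,
      pdMat_congr h.isOpen h.coframe_mul_frame hp, pdMat_const]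
  calc pdMat i E p = E p * Θ p * pdMat i E p := by
        rw [h.frame_mul_coframe hp, Matrix.one_mul]
    _ = E p * (Θ p * pdMat i E p) := Matrix.mul_assoc _ _ _
    _ = E p * -(pdMat i Θ p * E p) := by rw [eq_neg_of_add_eq_zero_right h0]
    _ = _ := by rw [Matrix.mul_neg, Matrix.mul_assoc]

/-- An endomorphism field with constant coefficients `n` in the coframe is parallel if `n`
commutes with the connection matrices. -/
theorem covDerivEnd_eq_zero (h : IsCartanConnectionOn U η Θ E φ)
    (hg : ∀ p ∈ U, g p = (Θ p)ᵀ * η * Θ p) (n : Matrix (Fin 4) (Fin 4) 𝕜)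
    (hn : ∀ i, ∀ p ∈ U, φ i p * n = n * φ i p) {p : Fin 4 → 𝕜} (hp : p ∈ U)
    (i k j : Fin 4) : covDerivEnd g (fun q => E q * n * Θ q) i k j p = 0 := by
  have hU := h.isOpen
  have hEΘ := h.frame_mul_coframe hp
  have hΘE := h.coframe_mul_frame p hp
  have key : pdMat i (fun q => E q * n * Θ q) p + connMat Θ E φ i p * (E p * n * Θ p)
      - E p * n * Θ p * connMat Θ E φ i p = 0 := by
    have e1 : pdMat i (fun q => E q * n * Θ q) p
        = -(E p * pdMat i Θ p * E p) * n * Θ p + E p * n * pdMat i Θ p := by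
      rw [pdMat_mul hU (h.smooth_frame.mul (.const n)) h.smooth_coframe hp,
        pdMat_mul hU h.smooth_frame (.const n) hp, pdMat_const, h.pdMat_frame hp]
      simp
    have e2 : connMat Θ E φ i p * (E p * n * Θ p)
        = E p * pdMat i Θ p * E p * n * Θ p + E p * (φ i p * n) * Θ p := by
      calc _ = E p * pdMat i Θ p * E p * n * Θ p + E p * φ i p * (Θ p * E p) * n * Θ p := by
            rw [connMat]; noncomm_ring
        _ = _ := by rw [hΘE, Matrix.mul_one]; simp only [Matrix.mul_assoc]
    have e3 : E p * n * Θ p * connMat Θ E φ i p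
        = E p * n * pdMat i Θ p + E p * (n * φ i p) * Θ p := by
      rw [Matrix.mul_assoc, h.coframe_mul_connMat hp]; noncomm_ring
    rw [e1, e2, e3, hn i p hp]
    noncomm_ring
  have := congrFun (congrFun key k) j
  simp only [pdMat_apply, Matrix.add_apply, Matrix.sub_apply, Matrix.mul_apply (M := connMat _ _ _ _ _),
    Matrix.mul_apply (N := connMat _ _ _ _ _), Matrix.zero_apply] at this
  simp only [covDerivEnd, h.christoffel_eq hg hp, h.connMat_symm hp i j]
  rw [← this]
  congr 1
  refine Finset.sum_congr rfl fun l _ => ?_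
  rw [mul_comm, h.connMat_symm hp]

/-- The curvature in coordinates is the curvature in the coframe, gauge transformed. -/
theorem riemannUp_eq (h : IsCartanConnectionOn U η Θ E φ)
    (hg : ∀ p ∈ U, g p = (Θ p)ᵀ * η * Θ p) {p : Fin 4 → 𝕜} (hp : p ∈ U) (l k i j : Fin 4) :
    riemannUp g l k i j p = (E p * curvMat φ i j p * Θ p) l k := by
  have hU := h.isOpen
  have hEΘ := h.frame_mul_coframe hp
  have hΘE := h.coframe_mul_frame p hp
  have hd : ∀ a b, pdMat a (connMat Θ E φ b) p
      = -(E p * pdMat a Θ p * E p) * (pdMat b Θ p + φ b p * Θ p)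
        + E p * (pdMat a (pdMat b Θ) p + (pdMat a (φ b) p * Θ p + φ b p * pdMat a Θ p)) := by
    intro a b
    have hs := (h.smooth_conn b).mul h.smooth_coframe
    have hpd := h.smooth_coframe.pdMat hU b
    change pdMat a (fun q => E q * (pdMat b Θ q + φ b q * Θ q)) p = _
    rw [pdMat_mul hU h.smooth_frame (hpd.add hs) hp, pdMat_add hU hpd hs hp,
      pdMat_mul hU (h.smooth_conn b) h.smooth_coframe hp, h.pdMat_frame hp]
  have hm : ∀ a b, connMat Θ E φ a p * connMat Θ E φ b p
      = E p * (pdMat a Θ p * E p + φ a p) * (pdMat b Θ p + φ b p * Θ p) := by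
    intro a b
    calc _ = E p * (pdMat a Θ p * E p + φ a p * (Θ p * E p)) * (pdMat b Θ p + φ b p * Θ p) := by
          simp only [connMat]; noncomm_ring
      _ = _ := by rw [hΘE, Matrix.mul_one]
  have key : pdMat i (connMat Θ E φ j) p - pdMat j (connMat Θ E φ i) p
      + (connMat Θ E φ i p * connMat Θ E φ j p - connMat Θ E φ j p * connMat Θ E φ i p)
      = E p * curvMat φ i j p * Θ p := by
    rw [hd, hd, hm, hm, pdMat_comm hU h.smooth_coframe hp j i, curvMat]
    noncomm_ring
  have hΓ : ∀ a b, pd a (christoffel g l b k) p = pdMat a (connMat Θ E φ b) p l k :=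
    fun a b => pd_congr hU (fun q hq => h.christoffel_eq hg hq l b k) hp a
  rw [← key]
  simp only [riemannUp, hΓ, h.christoffel_eq hg hp, Finset.sum_sub_distrib, Matrix.add_apply,
    Matrix.sub_apply, Matrix.mul_apply]

theorem curvMat_swap (i j : Fin 4) (p : Fin 4 → 𝕜) : curvMat φ j i p = -curvMat φ i j p := by
  simp only [curvMat]; abel

/-- The first Bianchi identity, in the coframe. -/
theorem bianchi (h : IsCartanConnectionOn U η Θ E φ)
    (hg : ∀ p ∈ U, g p = (Θ p)ᵀ * η * Θ p) {p : Fin 4 → 𝕜} (hp : p ∈ U) (a k i j : Fin 4) :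
    (curvMat φ i j p * Θ p) a k + (curvMat φ j k p * Θ p) a i
      + (curvMat φ k i p * Θ p) a j = 0 := by
  have hc : ∀ l a b q, q ∈ U → christoffel g l a b q = christoffel g l b a q :=
    fun l a b q hq => by rw [h.christoffel_eq hg hq, h.christoffel_eq hg hq, h.connMat_symm hq]
  have hpc : ∀ l a b c, pd c (christoffel g l a b) p = pd c (christoffel g l b a) p :=
    fun l a b c => pd_congr h.isOpen (hc l a b) hp c
  have hR : ∀ l, riemannUp g l k i j p + riemannUp g l i j k p + riemannUp g l j k i p = 0 := by
    intro l
    simp only [riemannUp, Finset.sum_sub_distrib]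
    rw [hpc l j i k, hpc l k j i, hpc l k i j]
    simp only [hc _ j i p hp, hc _ k j p hp, hc _ k i p hp]
    ring
  have hΘ : ∀ M : Matrix (Fin 4) (Fin 4) 𝕜, ∀ b,
      (M * Θ p) a b = ∑ l, Θ p a l * (E p * M * Θ p) l b := by
    intro M b
    rw [← Matrix.mul_apply, ← Matrix.mul_assoc, ← Matrix.mul_assoc, h.coframe_mul_frame p hp,
      Matrix.one_mul]
  rw [hΘ, hΘ, hΘ, ← Finset.sum_add_distrib, ← Finset.sum_add_distrib]
  refine Finset.sum_eq_zero fun l _ => ?_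
  rw [← h.riemannUp_eq hg hp, ← h.riemannUp_eq hg hp, ← h.riemannUp_eq hg hp, ← mul_add,
    ← mul_add, hR, mul_zero]

end IsCartanConnectionOn

end Cartan

/-! ### The self-dual Weyl tensor in a null coframe -/

section Algebra

variable {𝕜 : Type*} [RCLike 𝕜]

/-- The coefficients of `e_Z ⊙ e_Z̃ - e_W ⊙ e_W̃` in a null coframe. -/
def nullEta (𝕜 : Type*) [RCLike 𝕜] : Matrix (Fin 4) (Fin 4) 𝕜 :=
  !![0, -1, 0, 0; -1, 0, 0, 0; 0, 0, 0, 1; 0, 0, 1, 0]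

/-- The infinitesimal isometries of `nullEta` that annihilate the self-dual form `θ³ ∧ θ¹`.
The entries `p, q, r` parametrise the anti-self-dual copy of `𝔰𝔩₂`; the entry `b` is the
coefficient of the nilpotent endomorphism, which lies in the self-dual copy and commutes with
all the others. -/
def spinMat (p q r b : 𝕜) : Matrix (Fin 4) (Fin 4) 𝕜 :=
  !![-p, 0, r, b; 0, p, 0, q; q, b, p, 0; 0, r, 0, -p]

theorem nullEta_transpose : (nullEta 𝕜)ᵀ = nullEta 𝕜 := by
  ext a b; fin_cases a <;> fin_cases b <;> rfl

theorem nullEta_mul_self : (nullEta 𝕜) * nullEta 𝕜 = 1 := by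
  ext a b
  fin_cases a <;> fin_cases b <;> simp [nullEta, Matrix.mul_apply, Fin.sum_univ_four]

theorem nullEta_mul_spinMat (p q r b : 𝕜) : nullEta 𝕜 * spinMat p q r b
    = !![0, -p, 0, -q; p, 0, -r, -b; 0, r, 0, -p; q, b, p, 0] := by
  ext i j
  fin_cases i <;> fin_cases j <;>
    simp [nullEta, spinMat, Matrix.mul_apply, Fin.sum_univ_four]

theorem spinMat_skew (p q r b : 𝕜) :
    (spinMat p q r b)ᵀ * nullEta 𝕜 + nullEta 𝕜 * spinMat p q r b = 0 := by
  have h : (spinMat p q r b)ᵀ * nullEta 𝕜 = (nullEta 𝕜 * spinMat p q r b)ᵀ := by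
    rw [Matrix.transpose_mul, nullEta_transpose]
  rw [h, nullEta_mul_spinMat]
  ext i j
  fin_cases i <;> fin_cases j <;> simp

theorem spinMat_commutator (p q r b p' q' r' b' : 𝕜) :
    spinMat p q r b * spinMat p' q' r' b' - spinMat p' q' r' b' * spinMat p q r b
      = spinMat (q * r' - q' * r) (2 * (p * q' - p' * q)) (2 * (r * p' - r' * p)) 0 := by
  ext i j
  fin_cases i <;> fin_cases j <;>
    simp [spinMat] <;> ring

theorem spinMat_congr (X P Q R B : Matrix (Fin 4) (Fin 4) 𝕜) (i j a b : Fin 4) :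
    spinMat ((Xᵀ * P * X) i j) ((Xᵀ * Q * X) i j) ((Xᵀ * R * X) i j) ((Xᵀ * B * X) i j) a b
      = ∑ c, ∑ d, X c i * X d j * spinMat (P c d) (Q c d) (R c d) (B c d) a b := by
  have h : ∀ M : Matrix (Fin 4) (Fin 4) 𝕜,
      (Xᵀ * M * X) i j = ∑ c, ∑ d, X c i * X d j * M c d := by
    intro M
    simp only [Matrix.mul_apply, Matrix.transpose_apply, Finset.sum_mul]
    rw [Finset.sum_comm]
    exact Finset.sum_congr rfl fun c _ => Finset.sum_congr rfl fun d _ => by ring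
  fin_cases a <;> fin_cases b <;> simp [spinMat, h]

theorem det_four_rows (u v w z : Fin 4 → 𝕜) : (Matrix.of ![u, v, w, z]).det =
    (u 0 * v 1 - u 1 * v 0) * (w 2 * z 3 - w 3 * z 2)
    - (u 0 * v 2 - u 2 * v 0) * (w 1 * z 3 - w 3 * z 1)
    + (u 0 * v 3 - u 3 * v 0) * (w 1 * z 2 - w 2 * z 1)
    + (u 1 * v 2 - u 2 * v 1) * (w 0 * z 3 - w 3 * z 0)
    - (u 1 * v 3 - u 3 * v 1) * (w 0 * z 2 - w 2 * z 0)
    + (u 2 * v 3 - u 3 * v 2) * (w 0 * z 1 - w 1 * z 0) := by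
  rw [Matrix.det_succ_row_zero]
  simp [Fin.sum_univ_four, Matrix.det_fin_three, Fin.succAbove]
  ring

theorem det_four_rows_eq_sum (u v w z : Fin 4 → 𝕜) : (Matrix.of ![u, v, w, z]).det =
    ∑ e, ∑ f, w e * z f * (Matrix.of ![u, v, Pi.single e 1, Pi.single f 1]).det := by
  simp only [det_four_rows, Fin.sum_univ_four, Pi.single_apply]
  simp
  ring

/-- How the Levi-Civita symbol transforms when its last two indices are contracted with a frame. -/
theorem sum_leviCivita (Θ E : Matrix (Fin 4) (Fin 4) 𝕜) (h : Θ * E = 1) (a b G H : Fin 4) :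
    ∑ e, ∑ f, Θ.det * leviCivita a b e f * (E e G * E f H)
      = (Matrix.of ![Θᵀ a, Θᵀ b, Pi.single G 1, Pi.single H 1]).det := by
  have e1 : (Matrix.of ![Pi.single a (1 : 𝕜), Pi.single b 1, Eᵀ G, Eᵀ H]) * Θᵀ
      = Matrix.of ![Θᵀ a, Θᵀ b, Pi.single G 1, Pi.single H 1] := by
    have hc : ∀ c, Eᵀ c ᵥ* Θᵀ = Pi.single c 1 := by
      intro c
      rw [Matrix.vecMul_transpose]
      ext d
      have := congrFun (congrFun h d) c
      rw [Matrix.one_apply] at this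
      rw [Pi.single_apply, ← this]
      rfl
    ext c d
    fin_cases c
    · simp [Matrix.mul_apply, Pi.single_apply]
    · simp [Matrix.mul_apply, Pi.single_apply]
    · exact congrFun (hc G) d
    · exact congrFun (hc H) d
  rw [← e1, Matrix.det_mul, Matrix.det_transpose, det_four_rows_eq_sum, Finset.sum_mul]
  refine Finset.sum_congr rfl fun e _ => ?_
  rw [Finset.sum_mul]
  refine Finset.sum_congr rfl fun f _ => ?_
  simp only [leviCivita, Matrix.transpose_apply]
  ring

/-- A two-form with components `x` in a null coframe satisfies `x + *x = 0` as soon as it pairs to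
zero with the self-dual forms `θ⁰ ∧ θ²`, `θ¹ ∧ θ³`, `θ² ∧ θ³ - θ⁰ ∧ θ¹`. -/
theorem antiSelfDual_pairing (x : Matrix (Fin 4) (Fin 4) 𝕜) (hx : ∀ a b, x b a = -x a b)
    (h02 : x 0 2 = 0) (h13 : x 1 3 = 0) (h23 : x 2 3 = x 0 1) (u v : Fin 4 → 𝕜) :
    ∑ a, ∑ b, u a * v b * x a b + (1 / 2) * ∑ G, ∑ H, (nullEta 𝕜 * x * nullEta 𝕜) G H *
      (Matrix.of ![u, v, Pi.single G 1, Pi.single H 1]).det = 0 := by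
  have hd : ∀ a, x a a = 0 := fun a => self_eq_neg.mp (hx a a)
  obtain ⟨α, β, γ, rfl⟩ : ∃ α β γ : 𝕜,
      x = !![0, α, 0, β; -α, 0, γ, 0; 0, -γ, 0, α; -β, 0, -α, 0] := by
    refine ⟨x 0 1, x 0 3, x 1 2, ?_⟩
    ext a b
    fin_cases a <;> fin_cases b <;> simp [hd, h02, h13, h23, hx 0 1, hx 0 2, hx 0 3, hx 1 2,
      hx 1 3, hx 2 3]
  have hy : nullEta 𝕜 * !![0, α, 0, β; -α, 0, γ, 0; 0, -γ, 0, α; -β, 0, -α, 0] * nullEta 𝕜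
      = !![0, -α, 0, -γ; α, 0, -β, 0; 0, β, 0, -α; γ, 0, α, 0] := by
    ext a b
    fin_cases a <;> fin_cases b <;> simp [nullEta, Matrix.mul_apply, Fin.sum_univ_four]
  rw [hy]
  simp only [det_four_rows, Fin.sum_univ_four]
  simp
  ring

/-- The covariant tensor of rank four whose components in the coframe `Θ` are `w`. -/
def pullback (Θ : Matrix (Fin 4) (Fin 4) 𝕜) (w : Fin 4 → Fin 4 → Fin 4 → Fin 4 → 𝕜)
    (l k i j : Fin 4) : 𝕜 :=
  ∑ a, ∑ b, ∑ c, ∑ d, Θ a l * Θ b k * Θ c i * Θ d j * w a b c d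

theorem pullback_swap_left (Θ : Matrix (Fin 4) (Fin 4) 𝕜)
    (w : Fin 4 → Fin 4 → Fin 4 → Fin 4 → 𝕜) (l k i j : Fin 4) :
    pullback Θ (fun a b c d => w b a c d) l k i j = pullback Θ w k l i j := by
  simp only [pullback]
  rw [Finset.sum_comm]
  simp only [mul_comm (Θ _ l)]

theorem pullback_swap_right (Θ : Matrix (Fin 4) (Fin 4) 𝕜)
    (w : Fin 4 → Fin 4 → Fin 4 → Fin 4 → 𝕜) (l k i j : Fin 4) :
    pullback Θ (fun a b c d => w a b d c) l k i j = pullback Θ w l k j i := by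
  simp only [pullback]
  refine Finset.sum_congr rfl fun a _ => Finset.sum_congr rfl fun b _ => ?_
  rw [Finset.sum_comm]
  exact Finset.sum_congr rfl fun c _ => Finset.sum_congr rfl fun d _ => by ring

theorem congr_apply (Θ x : Matrix (Fin 4) (Fin 4) 𝕜) (i j : Fin 4) :
    (Θᵀ * x * Θ) i j = ∑ a, ∑ b, Θ a i * Θ b j * x a b := by
  simp only [Matrix.mul_apply, Matrix.transpose_apply, Finset.sum_mul]
  rw [Finset.sum_comm]
  exact Finset.sum_congr rfl fun c _ => Finset.sum_congr rfl fun d _ => by ring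

theorem congr_mul_congr (Θ x y : Matrix (Fin 4) (Fin 4) 𝕜) (l k i j : Fin 4) :
    (Θᵀ * x * Θ) l i * (Θᵀ * y * Θ) k j = pullback Θ (fun a b c d => x a c * y b d) l k i j := by
  simp only [congr_apply, pullback, Finset.sum_mul]
  simp only [Finset.mul_sum]
  refine Finset.sum_congr rfl fun a _ => ?_
  rw [Finset.sum_comm]
  exact Finset.sum_congr rfl fun b _ => Finset.sum_congr rfl fun c _ =>
    Finset.sum_congr rfl fun d _ => by ring

/-- The components of the Weyl tensor in a null coframe, in terms of those of the curvature,
the Ricci tensor and the scalar curvature. -/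
def frameWeyl (r : Fin 4 → Fin 4 → Fin 4 → Fin 4 → 𝕜) (ρ : Matrix (Fin 4) (Fin 4) 𝕜) (S : 𝕜)
    (a b c d : Fin 4) : 𝕜 :=
  r a b c d - (1 / 2) * (nullEta 𝕜 a c * ρ b d - nullEta 𝕜 a d * ρ b c
      - nullEta 𝕜 b c * ρ a d + nullEta 𝕜 b d * ρ a c)
    + (S / 6) * (nullEta 𝕜 a c * nullEta 𝕜 b d - nullEta 𝕜 a d * nullEta 𝕜 b c)

theorem pullback_frameWeyl (Θ : Matrix (Fin 4) (Fin 4) 𝕜)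
    (r : Fin 4 → Fin 4 → Fin 4 → Fin 4 → 𝕜) (ρ : Matrix (Fin 4) (Fin 4) 𝕜) (S : 𝕜)
    (l k i j : Fin 4) : pullback Θ (frameWeyl r ρ S) l k i j
      = pullback Θ r l k i j - (1 / 2) * (
        (Θᵀ * nullEta 𝕜 * Θ) l i * (Θᵀ * ρ * Θ) k j - (Θᵀ * nullEta 𝕜 * Θ) l j * (Θᵀ * ρ * Θ) k i
        - (Θᵀ * nullEta 𝕜 * Θ) k i * (Θᵀ * ρ * Θ) l j + (Θᵀ * nullEta 𝕜 * Θ) k j * (Θᵀ * ρ * Θ) l i)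
      + (S / 6) * ((Θᵀ * nullEta 𝕜 * Θ) l i * (Θᵀ * nullEta 𝕜 * Θ) k j
        - (Θᵀ * nullEta 𝕜 * Θ) l j * (Θᵀ * nullEta 𝕜 * Θ) k i) := by
  have h1 : ∀ y : Matrix (Fin 4) (Fin 4) 𝕜, (Θᵀ * nullEta 𝕜 * Θ) l j * (Θᵀ * y * Θ) k i
      = pullback Θ (fun a b c d => nullEta 𝕜 a d * y b c) l k i j := fun y => by
    rw [congr_mul_congr, ← pullback_swap_right]
  have h2 : (Θᵀ * nullEta 𝕜 * Θ) k i * (Θᵀ * ρ * Θ) l j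
      = pullback Θ (fun a b c d => nullEta 𝕜 b c * ρ a d) l k i j := by
    rw [congr_mul_congr, ← pullback_swap_left]
  have h3 : (Θᵀ * nullEta 𝕜 * Θ) k j * (Θᵀ * ρ * Θ) l i
      = pullback Θ (fun a b c d => nullEta 𝕜 b d * ρ a c) l k i j := by
    rw [congr_mul_congr, ← pullback_swap_left, ← pullback_swap_right]
  rw [h1, h1, h2, h3, congr_mul_congr, congr_mul_congr]
  simp only [pullback, frameWeyl, mul_add, mul_sub, Finset.mul_sum, ← Finset.sum_add_distrib,
    ← Finset.sum_sub_distrib]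
  refine Finset.sum_congr rfl fun a _ => Finset.sum_congr rfl fun b _ =>
    Finset.sum_congr rfl fun c _ => Finset.sum_congr rfl fun d _ => by ring

end Algebra

section Curvature

variable {𝕜 : Type*} [RCLike 𝕜]

/-- The components in a null coframe of the curvature `spinMat A B C D`, where `A, B, C, D` are
the components of its two-form coefficients. -/
def spinCurv (A B C D : Matrix (Fin 4) (Fin 4) 𝕜) (a b c d : Fin 4) : 𝕜 :=
  (nullEta 𝕜 * spinMat (A c d) (B c d) (C c d) (D c d)) a b

/-- The Ricci tensor of the curvature `spinMat A B C D`. -/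
def spinRicci (A B C D : Matrix (Fin 4) (Fin 4) 𝕜) : Matrix (Fin 4) (Fin 4) 𝕜 :=
  Matrix.of fun b d => ∑ c, spinMat (A c d) (B c d) (C c d) (D c d) c b

theorem spinCurv_swap (A B C D : Matrix (Fin 4) (Fin 4) 𝕜) (a b c d : Fin 4) :
    spinCurv A B C D b a c d = -spinCurv A B C D a b c d := by
  simp only [spinCurv, nullEta_mul_spinMat]
  fin_cases a <;> fin_cases b <;> simp

theorem frameWeyl_swap {r : Fin 4 → Fin 4 → Fin 4 → Fin 4 → 𝕜}
    (hr : ∀ a b c d, r b a c d = -r a b c d) (ρ : Matrix (Fin 4) (Fin 4) 𝕜) (S : 𝕜)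
    (a b c d : Fin 4) : frameWeyl r ρ S b a c d = -frameWeyl r ρ S a b c d := by
  simp only [frameWeyl, hr a b]
  ring

/-- The algebraic heart of anti-self-duality.  The first Bianchi identity determines the curvature
`spinMat A B C D` up to eight parameters; the scalar curvature vanishes, and if moreover `D` is an
anti-self-dual two-form, then the self-dual part of the Weyl tensor is zero. -/
theorem frameWeyl_spinCurv (A B C D : Matrix (Fin 4) (Fin 4) 𝕜)
    (hA : ∀ c d, A d c = -A c d) (hB : ∀ c d, B d c = -B c d) (hC : ∀ c d, C d c = -C c d)
    (hD : ∀ c d, D d c = -D c d) (hD02 : D 0 2 = 0) (hD13 : D 1 3 = 0) (hD23 : D 2 3 = D 0 1)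
    (hbi : ∀ a b c d, spinMat (A c d) (B c d) (C c d) (D c d) a b
      + spinMat (A d b) (B d b) (C d b) (D d b) a c
      + spinMat (A b c) (B b c) (C b c) (D b c) a d = 0) (c d : Fin 4) :
    let w := frameWeyl (spinCurv A B C D) (spinRicci A B C D)
      (nullEta 𝕜 * spinRicci A B C D).trace
    w 0 2 c d = 0 ∧ w 1 3 c d = 0 ∧ w 2 3 c d = w 0 1 c d := by
  have diag : ∀ M : Matrix (Fin 4) (Fin 4) 𝕜, (∀ c d, M d c = -M c d) → ∀ c, M c c = 0 :=
    fun M hM c => self_eq_neg.mp (hM c c)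
  have b0 := hbi 0 0 1 2
  have b1 := hbi 0 0 1 3
  have b2 := hbi 0 0 2 3
  have b3 := hbi 0 1 2 3
  have b4 := hbi 1 0 1 2
  have b5 := hbi 1 0 1 3
  have b6 := hbi 1 0 2 3
  have b7 := hbi 1 1 2 3
  have b8 := hbi 2 0 1 2
  have b9 := hbi 2 0 1 3
  have b10 := hbi 2 0 2 3
  have b11 := hbi 2 1 2 3
  have b12 := hbi 3 0 1 2
  have b13 := hbi 3 0 1 3
  have b14 := hbi 3 1 2 3
  simp [spinMat] at b0 b1 b2 b3 b4 b5 b6 b7 b8 b9 b10 b11 b12 b13 b14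
  clear hbi
  -- Solve the Bianchi identities for the components of `A`, then those of `B` and `C`.
  obtain ⟨δ, μ, ν, rfl⟩ : ∃ δ μ ν : 𝕜,
      D = !![0, δ, 0, μ; -δ, 0, ν, 0; 0, -ν, 0, δ; -μ, 0, -δ, 0] := by
    refine ⟨D 0 1, D 0 3, D 1 2, ?_⟩
    ext a b
    fin_cases a <;> fin_cases b <;> simp [diag D hD, hD02, hD13, hD23, hD 0 1, hD 0 2, hD 0 3,
      hD 1 2, hD 1 3, hD 2 3]
  simp at b0 b1 b2 b3 b4 b5 b6 b7 b8 b9 b10 b11 b12 b13 b14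
  obtain ⟨α, β, γ, rfl⟩ : ∃ α β γ : 𝕜,
      A = !![0, α, 0, β; -α, 0, γ, δ; 0, -γ, 0, α; -β, -δ, -α, 0] := by
    refine ⟨A 0 1, A 0 3, A 1 2, ?_⟩
    have h02 : A 0 2 = 0 := by linear_combination -b4 + hA 2 0
    have h13 : A 1 3 = δ := by linear_combination -b1
    have h23 : A 2 3 = A 0 1 := by linear_combination b7 - b8
    ext a b
    fin_cases a <;> fin_cases b <;> simp [diag A hA, h02, h13, h23, hA 0 1, hA 0 2, hA 0 3,
      hA 1 2, hA 1 3, hA 2 3]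
  simp at b0 b2 b5 b7 b10 b12 b13 b14
  obtain ⟨ε, rfl⟩ : ∃ ε : 𝕜,
      B = !![0, β, 0, ε; -β, 0, -α, μ; 0, α, 0, β; -ε, -μ, -β, 0] := by
    refine ⟨B 0 3, ?_⟩
    have h01 : B 0 1 = β := by linear_combination b5
    have h12 : B 1 2 = -α := by linear_combination b7
    have h13 : B 1 3 = μ := by linear_combination b9
    have h23 : B 2 3 = β := by linear_combination b10
    ext a b
    fin_cases a <;> fin_cases b <;> simp [diag B hB, h01, b6, h12, h13, h23, hB 0 1, hB 0 2,
      hB 0 3, hB 1 2, hB 1 3, hB 2 3]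
  obtain ⟨κ, rfl⟩ : ∃ κ : 𝕜,
      C = !![0, γ, 0, -α; -γ, 0, κ, ν; 0, -κ, 0, γ; α, -ν, -γ, 0] := by
    refine ⟨C 1 2, ?_⟩
    have h01 : C 0 1 = γ := by linear_combination b0
    have h02 : C 0 2 = 0 := by linear_combination -b12 + hC 2 0
    have h03 : C 0 3 = -α := by linear_combination -b13 + hC 3 0
    have h13 : C 1 3 = ν := by linear_combination -b3 + hC 3 1
    have h23 : C 2 3 = γ := by linear_combination b14
    ext a b
    fin_cases a <;> fin_cases b <;> simp [diag C hC, h01, h02, h03, h13, h23, hC 0 1, hC 0 2,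
      hC 0 3, hC 1 2, hC 1 3, hC 2 3]
  clear b0 b1 b2 b3 b4 b5 b6 b7 b8 b9 b10 b11 b12 b13 b14 hA hB hC hD
  intro w
  obtain ⟨ρ, hρ⟩ : ∃ ρ : Matrix (Fin 4) (Fin 4) 𝕜,
      ρ = !![0, 0, 0, 0; 0, -2 * ν, 0, 2 * δ; 0, 0, 0, 0; 0, 2 * δ, 0, 2 * μ] := ⟨_, rfl⟩
  have hR : spinRicci !![0, α, 0, β; -α, 0, γ, δ; 0, -γ, 0, α; -β, -δ, -α, 0]
      !![0, β, 0, ε; -β, 0, -α, μ; 0, α, 0, β; -ε, -μ, -β, 0]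
      !![0, γ, 0, -α; -γ, 0, κ, ν; 0, -κ, 0, γ; α, -ν, -γ, 0]
      !![0, δ, 0, μ; -δ, 0, ν, 0; 0, -ν, 0, δ; -μ, 0, -δ, 0] = ρ := by
    rw [hρ]
    ext b d
    fin_cases b <;> fin_cases d <;> simp [spinRicci, spinMat, Fin.sum_univ_four] <;> ring
  have hS : (nullEta 𝕜 * ρ).trace = 0 := by
    rw [hρ]
    simp [nullEta, Matrix.trace, Fin.sum_univ_four]
  simp only [w, hR, hS, frameWeyl, spinCurv, nullEta_mul_spinMat]
  subst hρ
  fin_cases c <;> fin_cases d <;> simp [nullEta]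

end Curvature

section Assembly

variable {𝕜 : Type*} [RCLike 𝕜]

theorem spinCurv_eq_sum (A B C D : Matrix (Fin 4) (Fin 4) 𝕜) (a b c d : Fin 4) :
    spinCurv A B C D a b c d
      = ∑ m, nullEta 𝕜 a m * spinMat (A c d) (B c d) (C c d) (D c d) m b := by
  rw [spinCurv, Matrix.mul_apply]

theorem congr_cancel {Θ E : Matrix (Fin 4) (Fin 4) 𝕜} (hΘE : Θ * E = 1)
    (M : Matrix (Fin 4) (Fin 4) 𝕜) : Eᵀ * (Θᵀ * M * Θ) * E = M := by
  calc Eᵀ * (Θᵀ * M * Θ) * E = (Θ * E)ᵀ * M * (Θ * E) := by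
        simp only [Matrix.transpose_mul, Matrix.mul_assoc]
    _ = M := by rw [hΘE, Matrix.transpose_one, Matrix.one_mul, Matrix.mul_one]

theorem congr_antisymm {M : Matrix (Fin 4) (Fin 4) 𝕜} (hM : ∀ i j, M j i = -M i j)
    (X : Matrix (Fin 4) (Fin 4) 𝕜) (c d : Fin 4) : (Xᵀ * M * X) d c = -(Xᵀ * M * X) c d := by
  rw [congr_apply, congr_apply, Finset.sum_comm, ← Finset.sum_neg_distrib]
  refine Finset.sum_congr rfl fun a _ => ?_
  rw [← Finset.sum_neg_distrib]
  refine Finset.sum_congr rfl fun b _ => ?_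
  rw [hM]
  ring

/-- A tensor with components `w` in a null coframe, skew in its first two indices and pairing to
zero with the self-dual two-forms there, is anti-self-dual in its first two indices. -/
theorem pullback_antiSelfDual {Θ E : Matrix (Fin 4) (Fin 4) 𝕜} (hΘE : Θ * E = 1)
    {w : Fin 4 → Fin 4 → Fin 4 → Fin 4 → 𝕜} (hw : ∀ a b c d, w b a c d = -w a b c d)
    (hsd : ∀ c d, w 0 2 c d = 0 ∧ w 1 3 c d = 0 ∧ w 2 3 c d = w 0 1 c d) (a b c d : Fin 4) :
    pullback Θ w a b c d + (1 / 2) * ∑ e, ∑ f, Θ.det * leviCivita a b e f *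
      ∑ e', ∑ f', (E * nullEta 𝕜 * Eᵀ) e e' * (E * nullEta 𝕜 * Eᵀ) f f'
        * pullback Θ w e' f' c d = 0 := by
  obtain ⟨x, hx⟩ : ∃ x : Matrix (Fin 4) (Fin 4) 𝕜,
      x = Matrix.of fun a b => ∑ i, ∑ j, Θ i c * Θ j d * w a b i j := ⟨_, rfl⟩
  have hpull : ∀ l k, pullback Θ w l k c d = (Θᵀ * x * Θ) l k := by
    intro l k
    simp only [pullback, congr_apply, hx, Matrix.of_apply, Finset.mul_sum]
    refine Finset.sum_congr rfl fun a _ => Finset.sum_congr rfl fun b _ =>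
      Finset.sum_congr rfl fun i _ => Finset.sum_congr rfl fun j _ => by ring
  have hginv : (E * nullEta 𝕜 * Eᵀ)ᵀ = E * nullEta 𝕜 * Eᵀ := by
    simp [Matrix.transpose_mul, nullEta_transpose, Matrix.mul_assoc]
  have hraise : ∀ e f, ∑ e', ∑ f', (E * nullEta 𝕜 * Eᵀ) e e' * (E * nullEta 𝕜 * Eᵀ) f f'
        * pullback Θ w e' f' c d
      = ∑ G, ∑ H, E e G * E f H * (nullEta 𝕜 * x * nullEta 𝕜) G H := by
    intro e f
    have h1 := congr_apply (E * nullEta 𝕜 * Eᵀ)ᵀ (Θᵀ * x * Θ) e f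
    have h2 := congr_apply Eᵀ (nullEta 𝕜 * x * nullEta 𝕜) e f
    simp only [Matrix.transpose_transpose, Matrix.transpose_apply (E * nullEta 𝕜 * Eᵀ),
      Matrix.transpose_apply E] at h1 h2
    simp only [hpull]
    rw [← h1, ← h2, hginv]
    refine congrFun (congrFun ?_ e) f
    calc E * nullEta 𝕜 * Eᵀ * (Θᵀ * x * Θ) * (E * nullEta 𝕜 * Eᵀ)
        = E * nullEta 𝕜 * (Θ * E)ᵀ * x * (Θ * E) * nullEta 𝕜 * Eᵀ := by
          simp only [Matrix.transpose_mul, Matrix.mul_assoc]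
      _ = E * (nullEta 𝕜 * x * nullEta 𝕜) * Eᵀ := by
          rw [hΘE, Matrix.transpose_one]
          simp only [Matrix.mul_one, Matrix.mul_assoc]
  have hstar : ∑ e, ∑ f, Θ.det * leviCivita a b e f *
        (∑ G, ∑ H, E e G * E f H * (nullEta 𝕜 * x * nullEta 𝕜) G H)
      = ∑ G, ∑ H, (nullEta 𝕜 * x * nullEta 𝕜) G H *
        (Matrix.of ![Θᵀ a, Θᵀ b, Pi.single G 1, Pi.single H 1]).det := by
    simp only [← sum_leviCivita Θ E hΘE, Finset.mul_sum]
    rw [Finset.sum_comm_cycle]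
    refine Finset.sum_congr rfl fun G _ => ?_
    rw [Finset.sum_comm_cycle]
    refine Finset.sum_congr rfl fun H _ => Finset.sum_congr rfl fun e _ =>
      Finset.sum_congr rfl fun f _ => by ring
  have hxs : ∀ a b, x b a = -x a b := by
    intro a b
    simp only [hx, Matrix.of_apply, hw a b, mul_neg, Finset.sum_neg_distrib]
  simp only [hraise]
  rw [hstar, hpull, congr_apply]
  exact antiSelfDual_pairing x hxs (by simp [hx, (hsd _ _).1]) (by simp [hx, (hsd _ _).2.1])
    (by simp [hx, (hsd _ _).2.2]) (Θᵀ a) (Θᵀ b)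

variable {U : Set (Fin 4 → 𝕜)} {Θ E g : (Fin 4 → 𝕜) → Matrix (Fin 4) (Fin 4) 𝕜}
  {φ : Fin 4 → (Fin 4 → 𝕜) → Matrix (Fin 4) (Fin 4) 𝕜}

/-- A metric for which `θ³ ∧ θ¹` is parallel is anti-self-dual as soon as the only self-dual
component of its curvature, a two-form, is itself anti-self-dual. -/
theorem IsCartanConnectionOn.selfDualWeyl_eq_zero (h : IsCartanConnectionOn U (nullEta 𝕜) Θ E φ)
    (hg : ∀ p ∈ U, g p = (Θ p)ᵀ * nullEta 𝕜 * Θ p) {ν : (Fin 4 → 𝕜) → 𝕜} {p : Fin 4 → 𝕜}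
    (hp : p ∈ U) (hν : ν p = (Θ p).det) (P Q R B D : Matrix (Fin 4) (Fin 4) 𝕜)
    (hK : ∀ i j, curvMat φ i j p = spinMat (P i j) (Q i j) (R i j) (B i j))
    (hBD : B = (Θ p)ᵀ * D * Θ p) (hD02 : D 0 2 = 0) (hD13 : D 1 3 = 0) (hD23 : D 2 3 = D 0 1)
    (a b c d : Fin 4) : selfDualWeyl g ν a b c d p = 0 := by
  have hΘE := h.coframe_mul_frame p hp
  have hEΘ := h.frame_mul_coframe hp
  have hinv := h.metric_inv hg hp
  have hbianchi := h.bianchi hg hp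
  have hup := h.riemannUp_eq hg hp
  have hgp := hg p hp
  simp only [hK] at hbianchi hup
  have hsw : ∀ i j, spinMat (P j i) (Q j i) (R j i) (B j i)
      = -spinMat (P i j) (Q i j) (R i j) (B i j) := fun i j => by
    rw [← hK, ← hK, IsCartanConnectionOn.curvMat_swap]
  have hP : ∀ i j, P j i = -P i j := fun i j => by
    simpa [spinMat] using congrFun (congrFun (hsw i j) 1) 1
  have hQ : ∀ i j, Q j i = -Q i j := fun i j => by
    simpa [spinMat] using congrFun (congrFun (hsw i j) 2) 0
  have hR : ∀ i j, R j i = -R i j := fun i j => by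
    simpa [spinMat] using congrFun (congrFun (hsw i j) 3) 1
  have hB : ∀ i j, B j i = -B i j := fun i j => by
    simpa [spinMat] using congrFun (congrFun (hsw i j) 2) 1
  clear hK hsw
  generalize Θ p = θ at *
  generalize E p = e at *
  have hback : ∀ M : Matrix (Fin 4) (Fin 4) 𝕜, θᵀ * (eᵀ * M * e) * θ = M := congr_cancel hEΘ
  obtain ⟨A', hA'⟩ : ∃ A', A' = eᵀ * P * e := ⟨_, rfl⟩
  obtain ⟨B', hB'⟩ : ∃ B', B' = eᵀ * Q * e := ⟨_, rfl⟩
  obtain ⟨C', hC'⟩ : ∃ C', C' = eᵀ * R * e := ⟨_, rfl⟩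
  have hD' : D = eᵀ * B * e := by rw [hBD, congr_cancel hΘE]
  -- `K c d` is the curvature endomorphism on the `c`-th and `d`-th members of the null frame.
  obtain ⟨K, hK⟩ : ∃ K : Fin 4 → Fin 4 → Matrix (Fin 4) (Fin 4) 𝕜,
      K = fun c d => spinMat (A' c d) (B' c d) (C' c d) (D c d) := ⟨_, rfl⟩
  have hto : ∀ i j a b, spinMat (P i j) (Q i j) (R i j) (B i j) a b
      = ∑ c, ∑ d, θ c i * θ d j * K c d a b := by
    intro i j a b
    rw [hK, ← spinMat_congr θ A' B' C' D, hA', hB', hC', hD', hback, hback, hback, hback]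
  have hfrom : ∀ c d a b, K c d a b
      = ∑ i, ∑ j, e i c * e j d * spinMat (P i j) (Q i j) (R i j) (B i j) a b := by
    intro c d a b
    rw [hK, ← spinMat_congr e P Q R B, hA', hB', hC', ← hD']
  have hbi : ∀ a b c d, K c d a b + K d b a c + K b c a d = 0 := by
    have ht : ∀ a b c d, K c d a b = ∑ i, ∑ j, ∑ k, e i c * e j d * e k b *
        (spinMat (P i j) (Q i j) (R i j) (B i j) * θ) a k := by
      intro a b c d
      rw [hfrom]
      refine Finset.sum_congr rfl fun i _ => Finset.sum_congr rfl fun j _ => ?_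
      have : spinMat (P i j) (Q i j) (R i j) (B i j)
          = spinMat (P i j) (Q i j) (R i j) (B i j) * θ * e := by
        rw [Matrix.mul_assoc, hΘE, Matrix.mul_one]
      conv_lhs => rw [this, Matrix.mul_apply, Finset.mul_sum]
      exact Finset.sum_congr rfl fun k _ => by ring
    intro a b c d
    have h2 : K d b a c = ∑ i, ∑ j, ∑ k, e j d * e k b * e i c *
        (spinMat (P j k) (Q j k) (R j k) (B j k) * θ) a i := by
      rw [ht, Finset.sum_comm_cycle]
    have h3 : K b c a d = ∑ i, ∑ j, ∑ k, e k b * e i c * e j d *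
        (spinMat (P k i) (Q k i) (R k i) (B k i) * θ) a j := by
      rw [ht, ← Finset.sum_comm_cycle]
    rw [ht a b c d, h2, h3]
    simp only [← Finset.sum_add_distrib]
    refine Finset.sum_eq_zero fun i _ => Finset.sum_eq_zero fun j _ =>
      Finset.sum_eq_zero fun k _ => ?_
    linear_combination e i c * e j d * e k b * hbianchi a k i j
  have hriem : ∀ l k i j, riemann g l k i j p = pullback θ (spinCurv A' B' C' D) l k i j := by
    intro l k i j
    have h1 : riemann g l k i j p
        = (θᵀ * (nullEta 𝕜 * spinMat (P i j) (Q i j) (R i j) (B i j)) * θ) l k := by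
      simp only [riemann, hup]
      rw [← Matrix.mul_apply, hgp]
      refine congrFun (congrFun ?_ l) k
      calc θᵀ * nullEta 𝕜 * θ * (e * spinMat (P i j) (Q i j) (R i j) (B i j) * θ)
          = θᵀ * nullEta 𝕜 * (θ * e) * spinMat (P i j) (Q i j) (R i j) (B i j) * θ := by
            simp only [Matrix.mul_assoc]
        _ = _ := by rw [hΘE, Matrix.mul_one]; simp only [Matrix.mul_assoc]
    rw [h1, congr_apply, pullback]
    refine Finset.sum_congr rfl fun a _ => Finset.sum_congr rfl fun b _ => ?_
    simp only [spinCurv_eq_sum, Matrix.mul_apply, hto, Finset.mul_sum, hK]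
    rw [Finset.sum_comm_cycle, Finset.sum_comm_cycle]
    refine Finset.sum_congr rfl fun i _ => Finset.sum_congr rfl fun j _ =>
      Finset.sum_congr rfl fun k _ => by ring
  have hric : ∀ k j, ricci g k j p = (θᵀ * spinRicci A' B' C' D * θ) k j := by
    intro k j
    have hM : ∀ a b, ∑ i, e i a * spinMat (P i j) (Q i j) (R i j) (B i j) a b
        = ∑ d, θ d j * K a d a b := by
      intro a b
      have : ∀ i, spinMat (P i j) (Q i j) (R i j) (B i j) a b
          = (θᵀ * (Matrix.of (fun c d => K c d a b) * θ)) i j := by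
        intro i
        rw [hto, ← Matrix.mul_assoc, congr_apply]; rfl
      simp only [this]
      have h2 : ∑ i, e i a * (θᵀ * (Matrix.of (fun c d => K c d a b) * θ)) i j
          = (eᵀ * (θᵀ * (Matrix.of (fun c d => K c d a b) * θ))) a j := by
        rw [Matrix.mul_apply]; rfl
      rw [h2, ← Matrix.mul_assoc, ← Matrix.transpose_mul, hΘE, Matrix.transpose_one,
        Matrix.one_mul, Matrix.mul_apply]
      exact Finset.sum_congr rfl fun d _ => mul_comm _ _
    calc ricci g k j p = ∑ i, ∑ b, ∑ a,
          θ b k * (e i a * spinMat (P i j) (Q i j) (R i j) (B i j) a b) := by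
          simp only [ricci, hup, Matrix.mul_apply, Finset.sum_mul]
          exact Finset.sum_congr rfl fun i _ => Finset.sum_congr rfl fun b _ =>
            Finset.sum_congr rfl fun a _ => by ring
      _ = ∑ b, ∑ a, θ b k * ∑ i, e i a * spinMat (P i j) (Q i j) (R i j) (B i j) a b := by
          simp only [Finset.mul_sum]
          rw [← Finset.sum_comm_cycle]
      _ = _ := by
          simp only [hM, congr_apply, spinRicci, Matrix.of_apply, Finset.mul_sum, hK]
          refine Finset.sum_congr rfl fun b _ => ?_
          rw [Finset.sum_comm]
          exact Finset.sum_congr rfl fun d _ => Finset.sum_congr rfl fun a _ => by ring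
  have hscal : scalarCurv g p = (nullEta 𝕜 * spinRicci A' B' C' D).trace := by
    have h1 : scalarCurv g p
        = ((e * nullEta 𝕜 * eᵀ)ᵀ * (θᵀ * spinRicci A' B' C' D * θ)).trace := by
      simp only [scalarCurv, hinv, hric, Matrix.trace, Matrix.diag_apply,
        Matrix.mul_apply (M := (e * nullEta 𝕜 * eᵀ)ᵀ), Matrix.transpose_apply (e * nullEta 𝕜 * eᵀ)]
      exact Finset.sum_comm
    have h2 : (e * nullEta 𝕜 * eᵀ)ᵀ * (θᵀ * spinRicci A' B' C' D * θ)
        = e * (nullEta 𝕜 * spinRicci A' B' C' D * θ) := by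
      calc _ = e * nullEta 𝕜 * (θ * e)ᵀ * spinRicci A' B' C' D * θ := by
            simp only [Matrix.transpose_mul, Matrix.transpose_transpose, nullEta_transpose,
              Matrix.mul_assoc]
        _ = _ := by rw [hΘE, Matrix.transpose_one, Matrix.mul_one]; simp only [Matrix.mul_assoc]
    rw [h1, h2, Matrix.trace_mul_comm, Matrix.mul_assoc, hΘE, Matrix.mul_one]
  have hweyl : ∀ l k i j, weyl g l k i j p = pullback θ (frameWeyl (spinCurv A' B' C' D)
      (spinRicci A' B' C' D) (nullEta 𝕜 * spinRicci A' B' C' D).trace) l k i j := by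
    intro l k i j
    rw [pullback_frameWeyl, weyl, hriem, hscal, hgp]
    simp only [hric]
  subst hK
  have hsd := frameWeyl_spinCurv A' B' C' D (fun c d => by rw [hA', congr_antisymm hP])
    (fun c d => by rw [hB', congr_antisymm hQ]) (fun c d => by rw [hC', congr_antisymm hR])
    (fun c d => by rw [hD', congr_antisymm hB]) hD02 hD13 hD23 hbi
  have := pullback_antiSelfDual hΘE (frameWeyl_swap (spinCurv_swap A' B' C' D)
    (spinRicci A' B' C' D) (nullEta 𝕜 * spinRicci A' B' C' D).trace) hsd a b c d
  simp only [selfDualWeyl, starWeyl, hν, hinv, hweyl, this, mul_zero]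

end Assembly

/-! ### A coframe adapted to the parallel two-form -/

section Airy

variable {𝕜 : Type*} [RCLike 𝕜]

theorem pd_neg (f : (Fin 4 → 𝕜) → 𝕜) (p : Fin 4 → 𝕜) (i : Fin 4) :
    pd i (fun q => -f q) p = -pd i f p := by
  simp [pd, fderiv_fun_neg]

theorem pd_sub {f g : (Fin 4 → 𝕜) → 𝕜} {p : Fin 4 → 𝕜} (hf : DifferentiableAt 𝕜 f p)
    (hg : DifferentiableAt 𝕜 g p) (i : Fin 4) :
    pd i (fun q => f q - g q) p = pd i f p - pd i g p := by
  simp [pd, fderiv_fun_sub hf hg]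

theorem IsSmoothOn.spinMat {U : Set (Fin 4 → 𝕜)} {x y z w : (Fin 4 → 𝕜) → 𝕜}
    (hx : ContDiffOn 𝕜 ∞ x U) (hy : ContDiffOn 𝕜 ∞ y U) (hz : ContDiffOn 𝕜 ∞ z U)
    (hw : ContDiffOn 𝕜 ∞ w U) : IsSmoothOn U fun p => spinMat (x p) (y p) (z p) (w p) := by
  intro a b
  fin_cases a <;> fin_cases b <;>
    first | exact contDiffOn_const | exact hx | exact hy | exact hz | exact hw | exact hx.neg

/-- The partial derivatives of a curve of infinitesimal isometries, coefficient by coefficient. -/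
theorem pdMat_spinMat (x y z w : (Fin 4 → 𝕜) → 𝕜) (i : Fin 4) (p : Fin 4 → 𝕜) :
    pdMat i (fun q => spinMat (x q) (y q) (z q) (w q)) p
      = spinMat (pd i x p) (pd i y p) (pd i z p) (pd i w p) := by
  ext a b
  fin_cases a <;> fin_cases b <;>
    first | exact pd_const _ _ _ | exact pd_neg _ _ _ | rfl

/-- The scalar fields from which the structure is built: `τ = t`, `f = F`, `g = F'`,
`k = F'' + κ F'`, `l = 1 / k`, `e = exp y`, `u = exp (-y)`, with `F''' = -t F'`. -/
structure IsAiryData (U : Set (Fin 4 → 𝕜)) (κ : 𝕜) (τ f g k l e u : (Fin 4 → 𝕜) → 𝕜) : Prop where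
  isOpen : IsOpen U
  smooth_τ : ContDiffOn 𝕜 ∞ τ U
  smooth_f : ContDiffOn 𝕜 ∞ f U
  smooth_g : ContDiffOn 𝕜 ∞ g U
  smooth_k : ContDiffOn 𝕜 ∞ k U
  smooth_l : ContDiffOn 𝕜 ∞ l U
  smooth_e : ContDiffOn 𝕜 ∞ e U
  smooth_u : ContDiffOn 𝕜 ∞ u U
  mul_kl : ∀ p ∈ U, k p * l p = 1
  mul_eu : ∀ p ∈ U, e p * u p = 1
  pd_τ : ∀ p ∈ U, ∀ i, pd i τ p = if i = 0 then 1 else 0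
  pd_f : ∀ p ∈ U, ∀ i, pd i f p = if i = 0 then g p else 0
  pd_g : ∀ p ∈ U, ∀ i, pd i g p = if i = 0 then k p - κ * g p else 0
  pd_k : ∀ p ∈ U, ∀ i, pd i k p = if i = 0 then κ * k p - (κ ^ 2 + τ p) * g p else 0
  pd_l : ∀ p ∈ U, ∀ i, pd i l p
    = if i = 0 then -l p ^ 2 * (κ * k p - (κ ^ 2 + τ p) * g p) else 0
  pd_e : ∀ p ∈ U, ∀ i, pd i e p = if i = 2 then e p else 0
  pd_u : ∀ p ∈ U, ∀ i, pd i u p = if i = 2 then -u p else 0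

variable (κ : 𝕜) (τ f g k l e u : (Fin 4 → 𝕜) → 𝕜)

/-- The null coframe `θ⁰ = -dy + κ dz + (κ² + t) θ¹ / (u k)`, `θ¹ = dx - u (F dy + F' dz) / 2`,
`θ² = u k (dt - dz) / 2`, `θ³ = (dt + dz) / 2`. -/
noncomputable def airyCoframe (p : Fin 4 → 𝕜) : Matrix (Fin 4) (Fin 4) 𝕜 :=
  !![0, (κ ^ 2 + τ p) * (l p * e p), -1 - (κ ^ 2 + τ p) * (l p * f p) * (1 / 2),
      κ - (κ ^ 2 + τ p) * (l p * g p) * (1 / 2);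
    0, 1, -(u p * f p * (1 / 2)), -(u p * g p * (1 / 2));
    u p * k p * (1 / 2), 0, 0, -(u p * k p * (1 / 2));
    1 / 2, 0, 0, 1 / 2]

/-- The frame dual to `airyCoframe`; its members are the columns. -/
noncomputable def airyFrame (p : Fin 4 → 𝕜) : Matrix (Fin 4) (Fin 4) 𝕜 :=
  !![0, 0, e p * l p, 1;
    -(u p * f p * (1 / 2)), 1 + (κ ^ 2 + τ p) * (l p * f p) * (1 / 2),
      -(l p * (κ * f p + g p) * (1 / 2)), u p * (κ * f p + g p) * (1 / 2);
    -1, (κ ^ 2 + τ p) * (l p * e p), -(κ * (e p * l p)), κ;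
    0, 0, -(e p * l p), 1]

/-- The connection form of `airyCoframe` along the nilpotent endomorphism, `β = θ¹ / (u k)`. -/
noncomputable def nilForm (i : Fin 4) (p : Fin 4 → 𝕜) : 𝕜 :=
  ![0, l p * e p, -(l p * f p * (1 / 2)), -(l p * g p * (1 / 2))] i

/-- The Levi-Civita connection matrices of `airyCoframe`.  In the notation of `spinMat` the
connection forms are, with `s = (κ² + t) / (u k)` and `v = u F'`,
`p = s θ¹ + v s θ³`, `q = v θ⁰ + θ²`, `r = (1 / (u k)² - s (2 κ - v s) / (u k)) θ¹ - s θ³` and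
`β = θ¹ / (u k)`. -/
noncomputable def airyConn (i : Fin 4) (p : Fin 4 → 𝕜) : Matrix (Fin 4) (Fin 4) 𝕜 :=
  spinMat
    ((κ ^ 2 + τ p) * (l p * e p) * airyCoframe κ τ f g k l e u p 1 i
      + (κ ^ 2 + τ p) * (l p * g p) * airyCoframe κ τ f g k l e u p 3 i)
    (u p * g p * airyCoframe κ τ f g k l e u p 0 i + airyCoframe κ τ f g k l e u p 2 i)
    (e p * e p * (l p * l p) * (1 - (κ ^ 2 + τ p) * (2 * κ - (κ ^ 2 + τ p) * (l p * g p)))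
        * airyCoframe κ τ f g k l e u p 1 i
      - (κ ^ 2 + τ p) * (l p * e p) * airyCoframe κ τ f g k l e u p 3 i)
    (nilForm f g l e i p)

variable {κ τ f g k l e u} {U : Set (Fin 4 → 𝕜)}

namespace IsAiryData

theorem smooth_coframe (h : IsAiryData U κ τ f g k l e u) :
    IsSmoothOn U (airyCoframe κ τ f g k l e u) := by
  have h1 := h.smooth_τ
  have h2 := h.smooth_f
  have h3 := h.smooth_g
  have h4 := h.smooth_k
  have h5 := h.smooth_l
  have h6 := h.smooth_e
  have h7 := h.smooth_u
  intro a b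
  fin_cases a <;> fin_cases b <;> simp [airyCoframe] <;> fun_prop

theorem smooth_frame (h : IsAiryData U κ τ f g k l e u) :
    IsSmoothOn U (airyFrame κ τ f g l e u) := by
  have h1 := h.smooth_τ
  have h2 := h.smooth_f
  have h3 := h.smooth_g
  have h5 := h.smooth_l
  have h6 := h.smooth_e
  have h7 := h.smooth_u
  intro a b
  fin_cases a <;> fin_cases b <;> simp [airyFrame] <;> fun_prop

theorem smooth_nilForm (h : IsAiryData U κ τ f g k l e u) (i : Fin 4) :
    ContDiffOn 𝕜 ∞ (nilForm f g l e i) U := by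
  have h2 := h.smooth_f
  have h3 := h.smooth_g
  have h5 := h.smooth_l
  have h6 := h.smooth_e
  unfold nilForm
  fin_cases i <;> simp <;> fun_prop

theorem smooth_conn (h : IsAiryData U κ τ f g k l e u) (i : Fin 4) :
    IsSmoothOn U (airyConn κ τ f g k l e u i) := by
  have hΘ := h.smooth_coframe
  have hs : ContDiffOn 𝕜 ∞ (fun p => κ ^ 2 + τ p) U := contDiffOn_const.add h.smooth_τ
  have hle := h.smooth_l.mul h.smooth_e
  have hlg := h.smooth_l.mul h.smooth_g
  exact IsSmoothOn.spinMat
    (((hs.mul hle).mul (hΘ 1 i)).add ((hs.mul hlg).mul (hΘ 3 i)))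
    (((h.smooth_u.mul h.smooth_g).mul (hΘ 0 i)).add (hΘ 2 i))
    (((((h.smooth_e.mul h.smooth_e).mul (h.smooth_l.mul h.smooth_l)).mul
      (contDiffOn_const.sub (hs.mul (contDiffOn_const.sub (hs.mul hlg))))).mul (hΘ 1 i)).sub
        ((hs.mul hle).mul (hΘ 3 i)))
    (h.smooth_nilForm i)

theorem coframe_mul_frame (h : IsAiryData U κ τ f g k l e u) {p : Fin 4 → 𝕜} (hp : p ∈ U) :
    airyCoframe κ τ f g k l e u p * airyFrame κ τ f g l e u p = 1 := by
  have h1 := h.mul_kl p hp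
  have h2 := h.mul_eu p hp
  ext a b
  fin_cases a <;> fin_cases b <;>
    simp [airyCoframe, airyFrame, Matrix.mul_apply, Fin.sum_univ_four] <;> grind

set_option maxHeartbeats 2000000 in
theorem pdMat_coframe (h : IsAiryData U κ τ f g k l e u) {p : Fin 4 → 𝕜} (hp : p ∈ U)
    (i : Fin 4) : pdMat i (airyCoframe κ τ f g k l e u) p =
      (if i = 0 then
        !![0, (l p - (κ ^ 2 + τ p) * l p ^ 2 * (κ * k p - (κ ^ 2 + τ p) * g p)) * e p,
          -(l p - (κ ^ 2 + τ p) * l p ^ 2 * (κ * k p - (κ ^ 2 + τ p) * g p)) * f p * (1 / 2)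
            - (κ ^ 2 + τ p) * l p * g p * (1 / 2),
          -(l p - (κ ^ 2 + τ p) * l p ^ 2 * (κ * k p - (κ ^ 2 + τ p) * g p)) * g p * (1 / 2)
            - (κ ^ 2 + τ p) * l p * (k p - κ * g p) * (1 / 2);
          0, 0, -(u p * g p * (1 / 2)), -(u p * (k p - κ * g p) * (1 / 2));
          u p * (κ * k p - (κ ^ 2 + τ p) * g p) * (1 / 2), 0, 0,
            -(u p * (κ * k p - (κ ^ 2 + τ p) * g p) * (1 / 2));
          0, 0, 0, 0]
      else if i = 2 then
        !![0, (κ ^ 2 + τ p) * (l p * e p), 0, 0;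
          0, 0, u p * f p * (1 / 2), u p * g p * (1 / 2);
          -(u p * k p * (1 / 2)), 0, 0, u p * k p * (1 / 2);
          0, 0, 0, 0]
      else 0) := by
  have hU := h.isOpen.mem_nhds hp
  have h1 := (h.smooth_τ.contDiffAt hU).differentiableAt (by simp)
  have h2 := (h.smooth_f.contDiffAt hU).differentiableAt (by simp)
  have h3 := (h.smooth_g.contDiffAt hU).differentiableAt (by simp)
  have h4 := (h.smooth_k.contDiffAt hU).differentiableAt (by simp)
  have h5 := (h.smooth_l.contDiffAt hU).differentiableAt (by simp)
  have h6 := (h.smooth_e.contDiffAt hU).differentiableAt (by simp)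
  have h7 := (h.smooth_u.contDiffAt hU).differentiableAt (by simp)
  ext a b
  rw [pdMat_apply]
  fin_cases a <;> fin_cases b <;> fin_cases i <;>
    simp (disch := fun_prop) [airyCoframe, pd_mul, pd_add, pd_sub, pd_neg, pd_const, h.pd_τ p hp,
      h.pd_f p hp, h.pd_g p hp, h.pd_k p hp, h.pd_l p hp, h.pd_e p hp, h.pd_u p hp] <;> ring

set_option maxHeartbeats 2000000 in
/-- The structure equations `dθ + φ ∧ θ = 0`.  This is where the Airy equation enters: the component
of `dθ²` along `dt` needs `k' = κ k - (κ² + t) F'`. -/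
theorem torsion (h : IsAiryData U κ τ f g k l e u) {p : Fin 4 → 𝕜} (hp : p ∈ U)
    (i j a : Fin 4) :
    (pdMat i (airyCoframe κ τ f g k l e u) p
        + airyConn κ τ f g k l e u i p * airyCoframe κ τ f g k l e u p) a j
      = (pdMat j (airyCoframe κ τ f g k l e u) p
        + airyConn κ τ f g k l e u j p * airyCoframe κ τ f g k l e u p) a i := by
  wlog hij : i < j generalizing i j
  · rcases eq_or_lt_of_le (not_lt.mp hij) with rfl | h'
    · rfl
    · exact (this j i h').symm
  have h1 := h.mul_kl p hp
  have h2 := h.mul_eu p hp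
  have hk : k p ≠ 0 := left_ne_zero_of_mul_eq_one h1
  have he : e p ≠ 0 := left_ne_zero_of_mul_eq_one h2
  have hl : l p = (k p)⁻¹ := eq_inv_of_mul_eq_one_right h1
  have hu : u p = (e p)⁻¹ := eq_inv_of_mul_eq_one_right h2
  rw [h.pdMat_coframe hp, h.pdMat_coframe hp]
  simp only [Matrix.add_apply, Matrix.mul_apply, Fin.sum_univ_four, airyConn, nilForm, hl, hu,
    airyCoframe]
  generalize τ p = t
  generalize f p = x
  generalize g p = y
  generalize k p = z at *
  generalize e p = w at *
  clear h1 h2 hl hu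
  fin_cases i <;> fin_cases j <;> first
    | exact absurd hij (by decide)
    | (fin_cases a <;> simp [spinMat] <;> field_simp <;> ring)

theorem isCartanConnectionOn (h : IsAiryData U κ τ f g k l e u) :
    IsCartanConnectionOn U (nullEta 𝕜) (airyCoframe κ τ f g k l e u) (airyFrame κ τ f g l e u)
      (airyConn κ τ f g k l e u) where
  isOpen := h.isOpen
  metric_symm := nullEta_transpose
  metric_sq := nullEta_mul_self
  smooth_coframe := h.smooth_coframe
  smooth_frame := h.smooth_frame
  smooth_conn := h.smooth_conn
  coframe_mul_frame _ hp := h.coframe_mul_frame hp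
  skew _ _ _ := spinMat_skew _ _ _ _
  torsion _ hp i j a := h.torsion hp i j a

variable (κ τ f g l e) in
/-- The components of `dβ` in `airyCoframe`, for `β = nilForm`.  There is no `θ⁰ ∧ θ²` or
`θ¹ ∧ θ³` component, and those along `θ⁰ ∧ θ¹` and `θ² ∧ θ³` agree: `dβ` is anti-self-dual. -/
def nilCurv (p : Fin 4 → 𝕜) : Matrix (Fin 4) (Fin 4) 𝕜 :=
  let x := e p * l p
  let y := g p * l p
  let z := e p ^ 2 * l p ^ 2 * (2 * κ - (κ ^ 2 + τ p) * (l p * g p))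
  !![0, -x, 0, -y; x, 0, z, 0; 0, -z, 0, -x; y, 0, x, 0]

set_option maxHeartbeats 2000000 in
/-- The nilpotent part `dβ` of the curvature, computed in the null coframe. -/
theorem nilForm_curvature (h : IsAiryData U κ τ f g k l e u) {p : Fin 4 → 𝕜} (hp : p ∈ U) :
    Matrix.of (fun i j => pd i (nilForm f g l e j) p - pd j (nilForm f g l e i) p)
      = (airyCoframe κ τ f g k l e u p)ᵀ * nilCurv κ τ g l e p
        * airyCoframe κ τ f g k l e u p := by
  have hU := h.isOpen.mem_nhds hp
  have h1 := (h.smooth_τ.contDiffAt hU).differentiableAt (by simp)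
  have h2 := (h.smooth_f.contDiffAt hU).differentiableAt (by simp)
  have h3 := (h.smooth_g.contDiffAt hU).differentiableAt (by simp)
  have h5 := (h.smooth_l.contDiffAt hU).differentiableAt (by simp)
  have h6 := (h.smooth_e.contDiffAt hU).differentiableAt (by simp)
  have hd : ∀ i, pd i (nilForm f g l e 0) p = 0 ∧
      pd i (nilForm f g l e 1) p = pd i l p * e p + l p * pd i e p ∧
      pd i (nilForm f g l e 2) p = -((pd i l p * f p + l p * pd i f p) * (1 / 2)) ∧
      pd i (nilForm f g l e 3) p = -((pd i l p * g p + l p * pd i g p) * (1 / 2)) := by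
    intro i
    refine ⟨pd_const i 0 p, pd_mul h5 h6 i, ?_, ?_⟩
    · change pd i (fun q => -(l q * f q * (1 / 2))) p = _
      simp (disch := fun_prop) only [pd_neg, pd_mul, pd_const]
      ring
    · change pd i (fun q => -(l q * g q * (1 / 2))) p = _
      simp (disch := fun_prop) only [pd_neg, pd_mul, pd_const]
      ring
  have m1 := h.mul_kl p hp
  have m2 := h.mul_eu p hp
  have hk : k p ≠ 0 := left_ne_zero_of_mul_eq_one m1
  have he : e p ≠ 0 := left_ne_zero_of_mul_eq_one m2
  have hl : l p = (k p)⁻¹ := eq_inv_of_mul_eq_one_right m1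
  have hu : u p = (e p)⁻¹ := eq_inv_of_mul_eq_one_right m2
  ext i j
  rw [congr_apply, Matrix.of_apply]
  simp only [Fin.sum_univ_four, airyCoframe, nilCurv]
  fin_cases i <;> fin_cases j <;>
    simp [hd, h.pd_f p hp, h.pd_g p hp, h.pd_l p hp, h.pd_e p hp, hl, hu] <;>
    field_simp <;> ring

/-- The metric of `airyCoframe` is anti-self-dual. -/
theorem selfDualWeyl_eq_zero (h : IsAiryData U κ τ f g k l e u)
    {G : (Fin 4 → 𝕜) → Matrix (Fin 4) (Fin 4) 𝕜}
    (hG : ∀ p ∈ U, G p = (airyCoframe κ τ f g k l e u p)ᵀ * nullEta 𝕜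
      * airyCoframe κ τ f g k l e u p)
    {ν : (Fin 4 → 𝕜) → 𝕜} (hν : ∀ p ∈ U, ν p = (airyCoframe κ τ f g k l e u p).det)
    {p : Fin 4 → 𝕜} (hp : p ∈ U) (a b c d : Fin 4) : selfDualWeyl G ν a b c d p = 0 := by
  have hadd : ∀ x y z w x' y' z' w' : 𝕜, spinMat x y z w + spinMat x' y' z' w'
      = spinMat (x + x') (y + y') (z + z') (w + w') := by
    intros
    ext a b
    fin_cases a <;> fin_cases b <;> simp [spinMat] <;> ring
  have hsub : ∀ x y z w x' y' z' w' : 𝕜, spinMat x y z w - spinMat x' y' z' w'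
      = spinMat (x - x') (y - y') (z - z') (w - w') := by
    intros
    ext a b
    fin_cases a <;> fin_cases b <;> simp [spinMat] <;> ring
  obtain ⟨x, y, z, hφ⟩ : ∃ x y z : Fin 4 → (Fin 4 → 𝕜) → 𝕜, airyConn κ τ f g k l e u
      = fun i q => spinMat (x i q) (y i q) (z i q) (nilForm f g l e i q) :=
    ⟨_, _, _, rfl⟩
  -- The nilpotent part commutes with everything, so the commutators contribute nothing to it.
  exact h.isCartanConnectionOn.selfDualWeyl_eq_zero hG hp (hν p hp)
    (Matrix.of fun i j => pd i (x j) p - pd j (x i) p + (y i p * z j p - y j p * z i p))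
    (Matrix.of fun i j => pd i (y j) p - pd j (y i) p + 2 * (x i p * y j p - x j p * y i p))
    (Matrix.of fun i j => pd i (z j) p - pd j (z i) p + 2 * (z i p * x j p - z j p * x i p))
    (Matrix.of fun i j => pd i (nilForm f g l e j) p - pd j (nilForm f g l e i) p)
    (nilCurv κ τ g l e p) (fun i j => by
      rw [hφ, curvMat, pdMat_spinMat, pdMat_spinMat, spinMat_commutator, hsub, hadd, add_zero]
      simp only [Matrix.of_apply]) (h.nilForm_curvature hp) (by simp [nilCurv]) (by simp [nilCurv])
    (by simp [nilCurv]) a b c d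

end IsAiryData

end Airy

/-! ### Solutions of the Airy equation -/

section Solutions

variable {𝕜 : Type*} [RCLike 𝕜]

/-- The Airy equation makes its solutions smooth, by induction on the order of differentiability. -/
theorem SolvesAiryOn.contDiffOn {G : 𝕜 → 𝕜} {T : Set 𝕜} (hG : SolvesAiryOn G T)
    (hT : IsOpen T) : ContDiffOn 𝕜 ∞ G T ∧ ContDiffOn 𝕜 ∞ (deriv G) T := by
  have h1 : DifferentiableOn 𝕜 G T := fun t ht => (hG t ht).1.differentiableWithinAt
  have h2 : DifferentiableOn 𝕜 (deriv G) T := fun t ht => (hG t ht).2.1.differentiableWithinAt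
  have key : ∀ n : ℕ, ContDiffOn 𝕜 n G T ∧ ContDiffOn 𝕜 n (deriv G) T := by
    intro n
    induction n with
    | zero =>
      exact ⟨contDiffOn_zero.2 h1.continuousOn, contDiffOn_zero.2 h2.continuousOn⟩
    | succ n ih =>
      have h3 : ContDiffOn 𝕜 n (deriv (deriv G)) T :=
        (contDiffOn_id.mul ih.1).neg.congr fun t ht => eq_neg_of_add_eq_zero_left (hG t ht).2.2
      push_cast
      exact ⟨(contDiffOn_succ_iff_deriv_of_isOpen hT).2 ⟨h1, by simp, ih.2⟩,
        (contDiffOn_succ_iff_deriv_of_isOpen hT).2 ⟨h2, by simp, h3⟩⟩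
  exact ⟨contDiffOn_infty.2 fun n => (key n).1, contDiffOn_infty.2 fun n => (key n).2⟩

theorem pd_comp_coord {A : 𝕜 → 𝕜} {a : 𝕜} {p : Fin 4 → 𝕜} {j : Fin 4}
    (h : HasDerivAt A a (p j)) (i : Fin 4) :
    pd i (fun q => A (q j)) p = if i = j then a else 0 := by
  have h' : HasFDerivAt (fun q : Fin 4 → 𝕜 => A (q j)) _ p :=
    h.hasFDerivAt.comp p (hasFDerivAt_apply j p)
  rw [pd, h'.fderiv]
  by_cases hij : i = j
  · subst hij; simp
  · simp [hij, Ne.symm hij]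

theorem contDiff_exp : ContDiff 𝕜 ∞ (NormedSpace.exp : 𝕜 → 𝕜) :=
  contDiff_iff_contDiffAt.2 fun x => (NormedSpace.exp_analytic (𝕂 := 𝕜) x).contDiffAt

theorem isOpen_domainOver {T : Set 𝕜} (hT : IsOpen T) : IsOpen (domainOver T) :=
  hT.preimage (continuous_apply 0)

/-- The scalar fields attached to a primitive `F` of a solution of the Airy equation. -/
theorem isAiryData {T : Set 𝕜} (hT : IsOpen T) {F : 𝕜 → 𝕜} (hF : DifferentiableOn 𝕜 F T)
    (hA : SolvesAiryOn (deriv F) T) {κ : 𝕜}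
    (hK : ∀ t ∈ T, deriv (deriv F) t + κ * deriv F t ≠ 0) :
    IsAiryData (domainOver T) κ (fun p => p 0) (fun p => F (p 0)) (fun p => deriv F (p 0))
      (fun p => deriv (deriv F) (p 0) + κ * deriv F (p 0))
      (fun p => (deriv (deriv F) (p 0) + κ * deriv F (p 0))⁻¹)
      (fun p => NormedSpace.exp (p 2)) (fun p => NormedSpace.exp (-p 2)) := by
  obtain ⟨sG, sH⟩ := hA.contDiffOn hT
  have sF : ContDiffOn 𝕜 ∞ F T := (contDiffOn_infty_iff_deriv_of_isOpen hT).2 ⟨hF, sG⟩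
  have sK : ContDiffOn 𝕜 ∞ (fun t => deriv (deriv F) t + κ * deriv F t) T :=
    sH.add (contDiffOn_const.mul sG)
  have hcomp : ∀ {A : 𝕜 → 𝕜}, ContDiffOn 𝕜 ∞ A T →
      ContDiffOn 𝕜 ∞ (fun p : Fin 4 → 𝕜 => A (p 0)) (domainOver T) := fun hA' =>
    hA'.comp (contDiff_apply 𝕜 𝕜 (0 : Fin 4)).contDiffOn fun _ hp => hp
  have dF : ∀ t ∈ T, HasDerivAt F (deriv F t) t := fun t ht =>
    ((hF t ht).differentiableAt (hT.mem_nhds ht)).hasDerivAt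
  have dG : ∀ t ∈ T, HasDerivAt (deriv F) (deriv (deriv F) t) t := fun t ht =>
    (hA t ht).1.hasDerivAt
  have dK : ∀ t ∈ T, HasDerivAt (fun t => deriv (deriv F) t + κ * deriv F t)
      (κ * (deriv (deriv F) t + κ * deriv F t) - (κ ^ 2 + t) * deriv F t) t := fun t ht => by
    refine ((hA t ht).2.1.hasDerivAt.add ((dG t ht).const_mul κ)).congr_deriv ?_
    linear_combination (hA t ht).2.2
  have de : ∀ x : 𝕜, HasDerivAt NormedSpace.exp (NormedSpace.exp x) x := fun x => hasDerivAt_exp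
  exact
  { isOpen := isOpen_domainOver hT
    smooth_τ := (contDiff_apply 𝕜 𝕜 (0 : Fin 4)).contDiffOn
    smooth_f := hcomp sF
    smooth_g := hcomp sG
    smooth_k := hcomp sK
    smooth_l := hcomp (sK.inv hK)
    smooth_e := (contDiff_exp.comp (contDiff_apply 𝕜 𝕜 (2 : Fin 4))).contDiffOn
    smooth_u := (contDiff_exp.comp (contDiff_apply 𝕜 𝕜 (2 : Fin 4)).neg).contDiffOn
    mul_kl := fun p hp => mul_inv_cancel₀ (hK _ hp)
    mul_eu := fun p _ => by
      rw [← NormedSpace.exp_add, add_neg_cancel, NormedSpace.exp_zero]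
    pd_τ := fun p _ i => pd_comp_coord (hasDerivAt_id (p 0)) i
    pd_f := fun p hp i => pd_comp_coord (dF _ hp) i
    pd_g := fun p hp i => by
      rw [pd_comp_coord (dG _ hp) i]; congr 1; ring
    pd_k := fun p hp i => pd_comp_coord (dK _ hp) i
    pd_l := fun p hp i => by
      rw [pd_comp_coord ((dK _ hp).fun_inv (hK _ hp)) i]
      congr 1
      field_simp
    pd_e := fun p _ i => pd_comp_coord (de _) i
    pd_u := fun p _ i => by
      have h := (de (-p 2)).comp (p 2) (hasDerivAt_neg (p 2))
      rw [mul_neg_one] at h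
      exact pd_comp_coord (A := fun y => NormedSpace.exp (-y)) h i }

end Solutions

/-! ### The null-Kähler structure -/

section NullKahler

variable {𝕜 : Type*} [RCLike 𝕜]

/-- The coefficients of the two-form `e_Z̃ ∧ e_W̃` in a null coframe. -/
def nullSigma (𝕜 : Type*) [RCLike 𝕜] : Matrix (Fin 4) (Fin 4) 𝕜 :=
  !![0, 0, 0, 0; 0, 0, 0, -1; 0, 0, 0, 0; 0, 1, 0, 0]

/-- The nilpotent endomorphism with `g(N X, Y) = Σ(X, Y)`, in a null frame. -/
def nullNilp (𝕜 : Type*) [RCLike 𝕜] : Matrix (Fin 4) (Fin 4) 𝕜 := spinMat 0 0 0 (-1)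

theorem nullNilp_transpose_mul_nullEta : (nullNilp 𝕜)ᵀ * nullEta 𝕜 = nullSigma 𝕜 := by
  ext a b
  fin_cases a <;> fin_cases b <;>
    simp [nullNilp, spinMat, nullEta, nullSigma, Matrix.mul_apply, Fin.sum_univ_four]

theorem nullSigma_transpose : (nullSigma 𝕜)ᵀ = -nullSigma 𝕜 := by
  ext a b
  fin_cases a <;> fin_cases b <;> simp [nullSigma]

theorem nullNilp_sq : nullNilp 𝕜 * nullNilp 𝕜 = 0 := by
  ext a b
  fin_cases a <;> fin_cases b <;>
    simp [nullNilp, spinMat, Matrix.mul_apply, Fin.sum_univ_four]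

theorem spinMat_commute_nullNilp (x y z w : 𝕜) :
    spinMat x y z w * nullNilp 𝕜 = nullNilp 𝕜 * spinMat x y z w := by
  rw [← sub_eq_zero, nullNilp, spinMat_commutator]
  ext a b
  fin_cases a <;> fin_cases b <;> simp [spinMat]

theorem spinMat_skew_nullSigma (x y z w : 𝕜) :
    (spinMat x y z w)ᵀ * nullSigma 𝕜 + nullSigma 𝕜 * spinMat x y z w = 0 := by
  have h := spinMat_skew x y z w
  have hc := congrArg Matrix.transpose (spinMat_commute_nullNilp x y z w)
  rw [Matrix.transpose_mul, Matrix.transpose_mul] at hc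
  rw [← nullNilp_transpose_mul_nullEta, ← Matrix.mul_assoc, ← hc, Matrix.mul_assoc,
    Matrix.mul_assoc, ← Matrix.mul_add, h, Matrix.mul_zero]

theorem rank_nullNilp : (nullNilp 𝕜).rank = 2 := by
  -- Reversing the order of the columns makes the matrix diagonal.
  let X : Matrix (Fin 4) (Fin 4) 𝕜 := !![0, 0, 0, 1; 0, 0, 1, 0; 0, 1, 0, 0; 1, 0, 0, 0]
  have hX : X * X = 1 := by
    ext a b
    fin_cases a <;> fin_cases b <;> simp [X, Matrix.mul_apply, Fin.sum_univ_four]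
  have hd : nullNilp 𝕜 * X = Matrix.diagonal ![-1, 0, -1, 0] := by
    ext a b
    fin_cases a <;> fin_cases b <;>
      simp [X, nullNilp, spinMat, Matrix.mul_apply, Fin.sum_univ_four]
  have hu : IsUnit X.det := IsUnit.of_mul_eq_one X.det (by
    rw [← Matrix.det_mul, hX, Matrix.det_one])
  rw [← Matrix.rank_mul_eq_left_of_isUnit_det X _ hu, hd, Matrix.rank_diagonal]
  rw [Fintype.card_subtype]
  have : (Finset.univ.filter fun i : Fin 4 => (![-1, 0, -1, 0] : Fin 4 → 𝕜) i ≠ 0) = {0, 2} := by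
    ext i
    fin_cases i <;> simp
  rw [this]
  rfl

theorem nullEta_signature : ∃ A : Matrix (Fin 4) (Fin 4) 𝕜,
    IsUnit A.det ∧ Aᵀ * nullEta 𝕜 * A = Matrix.diagonal ![1, 1, -1, -1] := by
  -- The columns are orthonormal combinations within the hyperbolic planes `⟨0, 1⟩` and `⟨2, 3⟩`.
  let A : Matrix (Fin 4) (Fin 4) 𝕜 :=
    !![1, 0, 1, 0; -(1 / 2), 0, 1 / 2, 0; 0, 1, 0, 1; 0, 1 / 2, 0, -(1 / 2)]
  let B : Matrix (Fin 4) (Fin 4) 𝕜 :=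
    !![1 / 2, -1, 0, 0; 0, 0, 1 / 2, 1; 1 / 2, 1, 0, 0; 0, 0, 1 / 2, -1]
  have hAB : A * B = 1 := by
    ext a b
    fin_cases a <;> fin_cases b <;>
      simp [A, B, Matrix.mul_apply, Fin.sum_univ_four] <;> norm_num
  refine ⟨A, IsUnit.of_mul_eq_one B.det (by rw [← Matrix.det_mul, hAB, Matrix.det_one]), ?_⟩
  ext a b
  fin_cases a <;> fin_cases b <;>
    simp [A, nullEta, Matrix.mul_apply, Fin.sum_univ_four] <;> norm_num

theorem dotProduct_mulVec_mulVec (A B : Matrix (Fin 4) (Fin 4) 𝕜) (X Y : Fin 4 → 𝕜) :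
    (A *ᵥ X) ⬝ᵥ (B *ᵥ Y) = X ⬝ᵥ ((Aᵀ * B) *ᵥ Y) := by
  rw [← Matrix.mulVec_mulVec, Matrix.dotProduct_mulVec X, Matrix.vecMul_transpose]

namespace IsCartanConnectionOn

variable {U : Set (Fin 4 → 𝕜)} {Θ E g S : (Fin 4 → 𝕜) → Matrix (Fin 4) (Fin 4) 𝕜}
  {φ : Fin 4 → (Fin 4 → 𝕜) → Matrix (Fin 4) (Fin 4) 𝕜}

theorem isNeutralMetricOn (h : IsCartanConnectionOn U (nullEta 𝕜) Θ E φ)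
    (hg : ∀ p ∈ U, g p = (Θ p)ᵀ * nullEta 𝕜 * Θ p) : IsNeutralMetricOn U g where
  smooth := h.smooth_metric hg
  symm p hp := by
    rw [Matrix.IsSymm, hg p hp]
    simp [Matrix.transpose_mul, nullEta_transpose, Matrix.mul_assoc]
  signature p hp := by
    obtain ⟨A, hA, hd⟩ := nullEta_signature (𝕜 := 𝕜)
    refine ⟨E p * A, ?_, ?_⟩
    · rw [Matrix.det_mul]
      exact (IsUnit.of_mul_eq_one (Θ p).det (by
        rw [← Matrix.det_mul, h.frame_mul_coframe hp, Matrix.det_one])).mul hA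
    · rw [← hd, hg p hp]
      calc _ = Aᵀ * (Θ p * E p)ᵀ * nullEta 𝕜 * (Θ p * E p) * A := by
            simp only [Matrix.transpose_mul, Matrix.mul_assoc]
        _ = _ := by rw [h.coframe_mul_frame p hp]; simp

/-- `g(N X, Y)` for `N = E n Θ`. -/
theorem endo_transpose_mul_metric (h : IsCartanConnectionOn U (nullEta 𝕜) Θ E φ)
    (hg : ∀ p ∈ U, g p = (Θ p)ᵀ * nullEta 𝕜 * Θ p) {p : Fin 4 → 𝕜} (hp : p ∈ U) :
    (E p * nullNilp 𝕜 * Θ p)ᵀ * g p = (Θ p)ᵀ * nullSigma 𝕜 * Θ p := by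
  rw [hg p hp, ← nullNilp_transpose_mul_nullEta]
  calc _ = (Θ p)ᵀ * (nullNilp 𝕜)ᵀ * (Θ p * E p)ᵀ * nullEta 𝕜 * Θ p := by
        simp only [Matrix.transpose_mul, Matrix.mul_assoc]
    _ = _ := by rw [h.coframe_mul_frame p hp]; simp [Matrix.mul_assoc]

theorem isNullKahlerOn (h : IsCartanConnectionOn U (nullEta 𝕜) Θ E φ)
    (hg : ∀ p ∈ U, g p = (Θ p)ᵀ * nullEta 𝕜 * Θ p)
    (hφ : ∀ i, ∀ p ∈ U, φ i p * nullNilp 𝕜 = nullNilp 𝕜 * φ i p) :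
    IsNullKahlerOn U g (fun p => E p * nullNilp 𝕜 * Θ p) where
  metric := h.isNeutralMetricOn hg
  smooth := (h.smooth_frame.mul (.const _)).mul h.smooth_coframe
  rank_eq p hp := by
    have hΘ : IsUnit (Θ p).det := IsUnit.of_mul_eq_one (E p).det (by
      rw [← Matrix.det_mul, h.coframe_mul_frame p hp, Matrix.det_one])
    have hE : IsUnit (E p).det := IsUnit.of_mul_eq_one (Θ p).det (by
      rw [← Matrix.det_mul, h.frame_mul_coframe hp, Matrix.det_one])
    rw [Matrix.rank_mul_eq_left_of_isUnit_det _ _ hΘ,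
      Matrix.rank_mul_eq_right_of_isUnit_det _ _ hE, rank_nullNilp]
  sq_eq_zero p hp := by
    calc _ = E p * nullNilp 𝕜 * (Θ p * E p) * nullNilp 𝕜 * Θ p := by
          simp only [Matrix.mul_assoc]
      _ = E p * (nullNilp 𝕜 * nullNilp 𝕜) * Θ p := by
          rw [h.coframe_mul_frame p hp, Matrix.mul_one]; simp only [Matrix.mul_assoc]
      _ = 0 := by rw [nullNilp_sq]; simp
  skew p hp X Y := by
    have hgs : (g p)ᵀ = g p := (h.isNeutralMetricOn hg).symm p hp
    have e1 := h.endo_transpose_mul_metric hg hp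
    have e2 : g p * (E p * nullNilp 𝕜 * Θ p) = -((Θ p)ᵀ * nullSigma 𝕜 * Θ p) := by
      have := congrArg Matrix.transpose e1
      rw [Matrix.transpose_mul, Matrix.transpose_transpose, hgs] at this
      rw [this, Matrix.transpose_mul, Matrix.transpose_mul, nullSigma_transpose,
        Matrix.transpose_transpose, ← Matrix.mul_assoc]
      simp
    rw [dotProduct_mulVec_mulVec, Matrix.mulVec_mulVec, e1, e2, Matrix.neg_mulVec,
      dotProduct_neg, add_neg_cancel]
  parallel p hp i k j := h.covDerivEnd_eq_zero hg _ hφ hp i k j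

theorem isNullKahlerFormOn (h : IsCartanConnectionOn U (nullEta 𝕜) Θ E φ)
    (hg : ∀ p ∈ U, g p = (Θ p)ᵀ * nullEta 𝕜 * Θ p)
    (hS : ∀ p ∈ U, S p = (Θ p)ᵀ * nullSigma 𝕜 * Θ p)
    (hφ : ∀ i, ∀ p ∈ U, (φ i p)ᵀ * nullSigma 𝕜 + nullSigma 𝕜 * φ i p = 0) :
    IsNullKahlerFormOn U g (fun p => E p * nullNilp 𝕜 * Θ p) S where
  smooth a b := (((h.smooth_coframe.transpose.mul (.const _)).mul h.smooth_coframe) a b).congr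
    fun p hp => by rw [hS p hp]
  alternating p hp := by
    rw [hS p hp, Matrix.transpose_mul, Matrix.transpose_mul, nullSigma_transpose,
      Matrix.transpose_transpose, ← Matrix.mul_assoc]
    simp
  eq_metric p hp X Y := by
    rw [dotProduct_mulVec_mulVec, h.endo_transpose_mul_metric hg hp, hS p hp]
  parallel p hp i j k := h.covDerivForm_eq_zero hg _ hS hφ hp i j k
  null p hp := by
    have hS' : ∀ i j, S p i j = Θ p 3 i * Θ p 1 j - Θ p 1 i * Θ p 3 j := by
      intro i j
      rw [hS p hp, congr_apply]
      simp [Fin.sum_univ_four, nullSigma]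
      ring
    simp only [wedgeTop, hS']
    ring

end IsCartanConnectionOn

end NullKahler

/-! ### From the tetrad to the adapted coframe -/

section Tetrad

variable {𝕜 : Type*} [RCLike 𝕜]

/-- The coframe dual to `tetrad F c₁ c₂`, as the rows of a matrix: with
`σ = e^y dx - (F dy + F' dz) / 2`, `K = F'' + (c₁ - c₂ / 2) F'` and `τ = dz - c₂ σ / K`, these are
`c₁ τ - dy + (c₁² + t) σ / K`, `σ / K`, `(dt - τ) / 2` and `(dt + τ) / 2`. -/
noncomputable def tetradDual (F : 𝕜 → 𝕜) (c₁ c₂ : 𝕜) (p : Fin 4 → 𝕜) :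
    Matrix (Fin 4) (Fin 4) 𝕜 :=
  let σ : Fin 4 → 𝕜 := (deriv (deriv F) (p 0) + (c₁ - c₂ / 2) * deriv F (p 0))⁻¹ •
    ![0, NormedSpace.exp (p 2), -(F (p 0) / 2), -(deriv F (p 0) / 2)]
  let τ : Fin 4 → 𝕜 := ![0, 0, 0, 1] - c₂ • σ
  Matrix.of ![c₁ • τ - ![0, 0, 1, 0] + (c₁ ^ 2 + p 0) • σ, σ,
    (1 / 2 : 𝕜) • (![1, 0, 0, 0] - τ), (1 / 2 : 𝕜) • (![1, 0, 0, 0] + τ)]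

/-- `tetradDual` really is dual to the tetrad; `K ≠ 0` is the determinant condition for the
tetrad to be a frame. -/
theorem tetradDual_mul_tetrad (F : 𝕜 → 𝕜) (c₁ c₂ : 𝕜) (p : Fin 4 → 𝕜)
    (hK : deriv (deriv F) (p 0) + (c₁ - c₂ / 2) * deriv F (p 0) ≠ 0) :
    tetradDual F c₁ c₂ p * Matrix.of (fun i b => tetrad F c₁ c₂ b p i) = 1 := by
  have hexp : NormedSpace.exp (p 2) * NormedSpace.exp (-p 2) = 1 := by
    rw [← NormedSpace.exp_add, add_neg_cancel, NormedSpace.exp_zero]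
  have he := left_ne_zero_of_mul_eq_one hexp
  have hu := eq_inv_of_mul_eq_one_right hexp
  obtain ⟨K, hKd⟩ : ∃ K, K = deriv (deriv F) (p 0) + (c₁ - c₂ / 2) * deriv F (p 0) := ⟨_, rfl⟩
  have hH : deriv (deriv F) (p 0) = K - (c₁ - c₂ / 2) * deriv F (p 0) := by rw [hKd]; ring
  rw [← hKd] at hK
  ext a b
  fin_cases a <;> fin_cases b <;>
    simp [tetradDual, tetrad, vecP, vecQ, vecR, vecT, vecL1, vecL2, vecL3, Matrix.mul_apply,
      Fin.sum_univ_four, ← hKd, hu] <;> field_simp <;> (try rw [hH]) <;> ring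

/-- A dual coframe is unique, so it is given by `tetradDual`. -/
theorem IsDualCoframeOn.eq_tetradDual {U : Set (Fin 4 → 𝕜)} {F : 𝕜 → 𝕜} {c₁ c₂ : 𝕜}
    {θ : Fin 4 → (Fin 4 → 𝕜) → (Fin 4 → 𝕜)} (hθ : IsDualCoframeOn U (tetrad F c₁ c₂) θ)
    {p : Fin 4 → 𝕜} (hp : p ∈ U)
    (hK : deriv (deriv F) (p 0) + (c₁ - c₂ / 2) * deriv F (p 0) ≠ 0) :
    Matrix.of (fun a => θ a p) = tetradDual F c₁ c₂ p := by
  have h1 := tetradDual_mul_tetrad F c₁ c₂ p hK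
  have h2 : Matrix.of (fun a => θ a p) * Matrix.of (fun i b => tetrad F c₁ c₂ b p i) = 1 := by
    ext a b
    rw [Matrix.one_apply, ← hθ p hp a b]
    rfl
  rw [mul_eq_one_comm] at h1
  calc _ = Matrix.of (fun a => θ a p) *
        (Matrix.of (fun i b => tetrad F c₁ c₂ b p i) * tetradDual F c₁ c₂ p) := by
        rw [h1, Matrix.mul_one]
    _ = _ := by rw [← Matrix.mul_assoc, h2, Matrix.one_mul]

/-- The change of null coframe from the dual of the tetrad to `airyCoframe`, for `c = c₂`.  It
absorbs the conformal factor `Ω` into the coframe, and it removes `c₂` except in the combination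
`κ = c₁ - c₂ / 2`. -/
def gaugeMat (Ω c : 𝕜) : Matrix (Fin 4) (Fin 4) 𝕜 :=
  !![1, -(c ^ 2 / 4), c / 2, -(c / 2); 0, Ω, 0, 0; 0, -(Ω * c / 2), Ω, 0; 0, c / 2, 0, 1]

theorem gaugeMat_metric (Ω c : 𝕜) :
    (gaugeMat Ω c)ᵀ * nullEta 𝕜 * gaugeMat Ω c = Ω • nullEta 𝕜 := by
  ext a b
  fin_cases a <;> fin_cases b <;>
    simp [gaugeMat, nullEta, Matrix.mul_apply, Fin.sum_univ_four] <;> ring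

theorem gaugeMat_form (Ω c : 𝕜) :
    (gaugeMat Ω c)ᵀ * nullSigma 𝕜 * gaugeMat Ω c = Ω • nullSigma 𝕜 := by
  ext a b
  fin_cases a <;> fin_cases b <;>
    simp [gaugeMat, nullSigma, Matrix.mul_apply, Fin.sum_univ_four]
  ring

theorem gaugeMat_det (Ω c : 𝕜) : (gaugeMat Ω c).det = Ω ^ 2 := by
  have : gaugeMat Ω c = Matrix.of ![![1, -(c ^ 2 / 4), c / 2, -(c / 2)], ![0, Ω, 0, 0],
    ![0, -(Ω * c / 2), Ω, 0], ![0, c / 2, 0, 1]] := rfl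
  rw [this, det_four_rows]
  simp
  ring

theorem congr_of_gauge {Θ C M s : Matrix (Fin 4) (Fin 4) 𝕜} {Ω : 𝕜} (hΘ : Θ = M * C)
    (hM : Mᵀ * s * M = Ω • s) : Cᵀ * (Ω • s) * C = Θᵀ * s * Θ := by
  rw [hΘ, ← hM]
  simp only [Matrix.transpose_mul, Matrix.mul_assoc]

theorem det_of_gauge {Θ C M : Matrix (Fin 4) (Fin 4) 𝕜} {Ω : 𝕜} (hΘ : Θ = M * C)
    (hM : M.det = Ω ^ 2) : Ω ^ 2 * C.det = Θ.det := by
  rw [hΘ, Matrix.det_mul, hM]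

theorem airyCoframe_eq_gauge (F : 𝕜 → 𝕜) (c₁ c₂ : 𝕜) (p : Fin 4 → 𝕜)
    (hK : deriv (deriv F) (p 0) + (c₁ - c₂ / 2) * deriv F (p 0) ≠ 0) :
    airyCoframe (c₁ - c₂ / 2) (fun p => p 0) (fun p => F (p 0)) (fun p => deriv F (p 0))
      (fun p => deriv (deriv F) (p 0) + (c₁ - c₂ / 2) * deriv F (p 0))
      (fun p => (deriv (deriv F) (p 0) + (c₁ - c₂ / 2) * deriv F (p 0))⁻¹)
      (fun p => NormedSpace.exp (p 2)) (fun p => NormedSpace.exp (-p 2)) p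
      = gaugeMat (confFactor F c₁ c₂ p) c₂ * tetradDual F c₁ c₂ p := by
  have hexp : NormedSpace.exp (p 2) * NormedSpace.exp (-p 2) = 1 := by
    rw [← NormedSpace.exp_add, add_neg_cancel, NormedSpace.exp_zero]
  have he := left_ne_zero_of_mul_eq_one hexp
  have hu := eq_inv_of_mul_eq_one_right hexp
  obtain ⟨K, hKd⟩ : ∃ K, K = deriv (deriv F) (p 0) + (c₁ - c₂ / 2) * deriv F (p 0) := ⟨_, rfl⟩
  rw [← hKd] at hK
  ext a b
  fin_cases a <;> fin_cases b <;>
    simp [airyCoframe, gaugeMat, tetradDual, confFactor, Matrix.mul_apply, Fin.sum_univ_four,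
      ← hKd, hu] <;> field_simp <;> ring

theorem tetradMetric_eq (Ω : (Fin 4 → 𝕜) → 𝕜) (θ : Fin 4 → (Fin 4 → 𝕜) → (Fin 4 → 𝕜))
    (p : Fin 4 → 𝕜) : tetradMetric Ω θ p
      = (Matrix.of fun a => θ a p)ᵀ * (Ω p • nullEta 𝕜) * Matrix.of fun a => θ a p := by
  ext i j
  rw [congr_apply]
  simp [tetradMetric, symProd, nullEta, Fin.sum_univ_four]
  ring

theorem tetradForm_eq (Ω : (Fin 4 → 𝕜) → 𝕜) (θ : Fin 4 → (Fin 4 → 𝕜) → (Fin 4 → 𝕜))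
    (p : Fin 4 → 𝕜) : tetradForm Ω θ p
      = (Matrix.of fun a => θ a p)ᵀ * (Ω p • nullSigma 𝕜) * Matrix.of fun a => θ a p := by
  ext i j
  rw [congr_apply]
  simp [tetradForm, wedge, nullSigma, Fin.sum_univ_four]
  ring

/-- Anti-self-duality and the null-Kähler property, for an arbitrary dual coframe `θ`.  On the
region considered, `θ` differs from `airyCoframe` by `gaugeMat` only. -/
theorem isASDOn_and_isNullKahlerOn {T : Set 𝕜} (hT : IsOpen T) {F : 𝕜 → 𝕜}
    (hF : DifferentiableOn 𝕜 F T) (hA : SolvesAiryOn (deriv F) T) {c₁ c₂ : 𝕜}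
    (hK : ∀ t ∈ T, deriv (deriv F) t + (c₁ - c₂ / 2) * deriv F t ≠ 0)
    {θ : Fin 4 → (Fin 4 → 𝕜) → (Fin 4 → 𝕜)}
    (hθ : IsDualCoframeOn (domainOver T) (tetrad F c₁ c₂) θ) :
    IsASDOn (domainOver T) (tetradMetric (confFactor F c₁ c₂) θ)
        (tetradVol (confFactor F c₁ c₂) θ) ∧
      ∃ N, IsNullKahlerOn (domainOver T) (tetradMetric (confFactor F c₁ c₂) θ) N ∧
        IsNullKahlerFormOn (domainOver T) (tetradMetric (confFactor F c₁ c₂) θ) N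
          (tetradForm (confFactor F c₁ c₂) θ) := by
  have hD := isAiryData hT hF hA hK
  have hC := hD.isCartanConnectionOn
  have hΘ : ∀ p ∈ domainOver T, _ = gaugeMat (confFactor F c₁ c₂ p) c₂
      * Matrix.of fun a => θ a p := fun p hp => by
    rw [hθ.eq_tetradDual hp (hK _ hp), ← airyCoframe_eq_gauge F c₁ c₂ p (hK _ hp)]
  have hg := fun p hp => (tetradMetric_eq (confFactor F c₁ c₂) θ p).trans
    (congr_of_gauge (hΘ p hp) (gaugeMat_metric _ _))
  have hS := fun p hp => (tetradForm_eq (confFactor F c₁ c₂) θ p).trans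
    (congr_of_gauge (hΘ p hp) (gaugeMat_form _ _))
  have hν := fun p hp => show tetradVol (confFactor F c₁ c₂) θ p = _ from
    det_of_gauge (hΘ p hp) (gaugeMat_det _ _)
  refine ⟨⟨?_, fun p hp => ?_, fun p hp a b c d => ?_⟩, _, hC.isNullKahlerOn hg ?_,
    hC.isNullKahlerFormOn hg hS ?_⟩
  · refine ContDiffOn.congr ?_ hν
    simp only [Matrix.det_apply']
    exact ContDiffOn.sum fun σ _ => contDiffOn_const.mul
      (contDiffOn_prod fun i _ => hC.smooth_coframe (σ i) i)
  · have hη : (nullEta 𝕜).det = 1 := by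
      have : nullEta 𝕜 = Matrix.of ![![0, -1, 0, 0], ![-1, 0, 0, 0], ![0, 0, 0, 1],
        ![0, 0, 1, 0]] := rfl
      rw [this, det_four_rows]
      simp
    rw [hg p hp, hν p hp, Matrix.det_mul, Matrix.det_mul, Matrix.det_transpose, hη]
    ring
  · exact hD.selfDualWeyl_eq_zero hg hν hp a b c d
  · exact fun i p _ => spinMat_commute_nullNilp _ _ _ _
  · exact fun i p _ => spinMat_skew_nullSigma _ _ _ _

theorem isDualCoframeOn_tetradDual {T : Set 𝕜} {F : 𝕜 → 𝕜} {c₁ c₂ : 𝕜}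
    (hK : ∀ t ∈ T, deriv (deriv F) t + (c₁ - c₂ / 2) * deriv F t ≠ 0) :
    IsDualCoframeOn (domainOver T) (tetrad F c₁ c₂) (fun a p => tetradDual F c₁ c₂ p a) := by
  intro p hp a b
  have h := congrFun (congrFun (tetradDual_mul_tetrad F c₁ c₂ p (hK _ hp)) a) b
  rw [Matrix.one_apply] at h
  exact h

theorem coframeZero_eq (F : 𝕜 → 𝕜) (a : Fin 4) (p : Fin 4 → 𝕜)
    (hK : deriv (deriv F) (p 0) ≠ 0) : coframeZero F a p = tetradDual F 0 0 p a := by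
  ext i
  fin_cases a <;> fin_cases i <;> simp [coframeZero, tetradDual, hK] <;> field_simp

end Tetrad

end AiryNullKahler

open AiryNullKahler in
theorem mainTheorem3 {𝕜 : Type*} [RCLike 𝕜] (T : Set 𝕜) (hT : IsOpen T) (F : 𝕜 → 𝕜)
    (hF : DifferentiableOn 𝕜 F T) (hAiry : SolvesAiryOn (deriv F) T) :
    ((∀ t ∈ T, deriv (deriv F) t ≠ 0) →
      IsDualCoframeOn (domainOver T) (tetrad F 0 0) (coframeZero F) ∧
      IsASDOn (domainOver T) (tetradMetric (confFactorZero F) (coframeZero F))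
        (tetradVol (confFactorZero F) (coframeZero F)) ∧
      ∃ N, IsNullKahlerOn (domainOver T) (tetradMetric (confFactorZero F) (coframeZero F)) N ∧
        IsNullKahlerFormOn (domainOver T) (tetradMetric (confFactorZero F) (coframeZero F)) N
          (tetradForm (confFactorZero F) (coframeZero F))) ∧
    (∀ c₁ c₂ : 𝕜, (∀ t ∈ T, deriv (deriv F) t + (c₁ - c₂ / 2) * deriv F t ≠ 0) →
      (∃ θ, IsDualCoframeOn (domainOver T) (tetrad F c₁ c₂) θ) ∧
      ∀ θ, IsDualCoframeOn (domainOver T) (tetrad F c₁ c₂) θ →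
        IsASDOn (domainOver T) (tetradMetric (confFactor F c₁ c₂) θ)
          (tetradVol (confFactor F c₁ c₂) θ) ∧
        ∃ N, IsNullKahlerOn (domainOver T) (tetradMetric (confFactor F c₁ c₂) θ) N ∧
          IsNullKahlerFormOn (domainOver T) (tetradMetric (confFactor F c₁ c₂) θ) N
            (tetradForm (confFactor F c₁ c₂) θ)) := by
  refine ⟨fun h0 => ?_, fun c₁ c₂ hK =>
    ⟨⟨_, isDualCoframeOn_tetradDual hK⟩, fun θ hθ => isASDOn_and_isNullKahlerOn hT hF hAiry hK hθ⟩⟩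
  have hK : ∀ t ∈ T, deriv (deriv F) t + ((0 : 𝕜) - 0 / 2) * deriv F t ≠ 0 := by
    simpa using h0
  have hθ : IsDualCoframeOn (domainOver T) (tetrad F 0 0) (coframeZero F) := fun p hp a b => by
    rw [coframeZero_eq F a p (h0 _ hp)]
    exact isDualCoframeOn_tetradDual hK p hp a b
  have hΩ : confFactorZero F = confFactor F 0 0 := by
    ext p
    simp [confFactorZero, confFactor]
  rw [hΩ]
  exact ⟨hθ, isASDOn_and_isNullKahlerOn hT hF hAiry hK hθ⟩
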